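/- **Setting.** Let $N\ge 1$. Consider $$\min\ \sum_{i=1}^{N} f_i(x_i)\quad\text{s.t.}\quad \sum_{i=1}^{N-1}A_ix_i+x_N=b,\qquad x_i\in\mathcal X_i\ (1\le i\le N-1),\ x_N\in\mathbf R^p,$$ where $A_i\in\mathbf R^{p\times n_i}$, $b\in\mathbf R^p$, $\mathcal X_i\subset\mathbf R^{n_i}$ is closed and convex, $f_i:\mathbf R^{n_i}\to\mathbf R$ is convex and bounded below on $\mathcal X_i$, with $f_i+\mathbf 1_{\mathcal X_i}$ coercive (that is, $f_i(x)\to+\infty$ as $\|x\|\to\infty$, $x\in\mathcal X_i$) for $i\le N-1$, and $f_N:\mathbf R^p\to\mathbf R$ is convex, bounded below and differentiable with $L$-Lipschitz gradient. Let $\gamma>\sqrt2\,L$, $r(u)=\sum_{i<N}A_ix_i+x_N-b$ for $u=(x_1,\dots,x_N)$, and for $w=(x_1,\dots,x_N,\lambda)$ $$\mathcal L_\gamma(w)=\sum_{i=1}^N f_i(x_i)-\langle\lambda,r(u)\rangle+\frac\gamma2\|r(u)\|^2\quad\text{if } x_i\in\mathcal X_i\ (i<N),\qquad \mathcal L_\gamma(w)=+\infty\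 \text{ otherwise.}$$ Let $w^k=(x_1^k,\dots,x_N^k,\lambda^k)$ be generated from an arbitrary $w^0$ by the multi-block ADMM: for $i=1,\dots,N$ in turn, $x_i^{k+1}$ is a minimizer over $x_i\in\mathcal X_i$ ($\mathcal X_N=\mathbf R^p$) of the augmented Lagrangian expression above at $(x_1^{k+1},\dots,x_{i-1}^{k+1},x_i,x_{i+1}^k,\dots,x_N^k,\lambda^k)$, and then $\lambda^{k+1}=\lambda^k-\gamma\,r(u^{k+1})$. Let $\Omega(w^0)$ be the set of limits of convergent subsequences of $(w^k)$. For $\eta\in(0,\infty]$ let $\Phi_\eta$ be the set of concave continuous $\varphi:[0,\eta)\to[0,\infty)$ with $\varphi(0)=0$ that are $C^1$ on $(0,\eta)$ with $\varphi'>0$ there. Let $\partial$ be the limiting subdifferential and $\operatorname{dist}(0,\emptyset)=\infty$. The function $\mathcal L_\gamma$ is a *KL function* if for each $w_0$ with $\partial\mathcal L_\gamma(w_0)\ne\emptyset$ there are $\eta\in(0,\infty]$, a neighbourhood $W_0$ of $w_0$ and $\varphi\in\Phi_\eta$ with $\varphi'(\mathcal L_\gamma(w)-\mathcal L_\gamma(w_0))\operatorname{dist}(0,\partial\mathcal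 L_\gamma(w))\ge1$ for all $w\in W_0$ with $\mathcal L_\gamma(w_0)<\mathcal L_\gamma(w)<\mathcal L_\gamma(w_0)+\eta$. For $w^*\in\Omega(w^0)$, call $(W,\eta,\varphi)$ *admissible* if $W$ is an open set containing $\Omega(w^0)$, $\eta\in(0,\infty]$, $\varphi\in\Phi_\eta$, the inequality $\varphi'(\mathcal L_\gamma(w)-\mathcal L_\gamma(w^*))\operatorname{dist}(0,\partial\mathcal L_\gamma(w))\ge1$ holds for all $w\in W$ with $\mathcal L_\gamma(w^*)<\mathcal L_\gamma(w)<\mathcal L_\gamma(w^*)+\eta$, and $w^k\in W$, $\mathcal L_\gamma(w^k)<\mathcal L_\gamma(w^*)+\eta$ for all $k\ge1$. Put $$\Delta_k=\sum_{i=1}^{N-1}\|A_ix_i^k-A_ix_i^{k+1}\|+\|x_N^k-x_N^{k+1}\|+\|\lambda^k-\lambda^{k+1}\|,$$ $$M=\max\Bigl(\gamma\sum_{i=1}^{N-1}\|A_i^\top\|,\ \frac1\gamma+1+\sum_{i=1}^{N-1}\|A_i^\top\|\Bigr),\qquad G(\varphi)=2\Delta_0+\frac{2M\gamma(1+L^2)}{\gamma^2-2L^2}\,\varphi\bigl(\mathcal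 L_\gamma(w^1)-\mathcal L_\gamma(w^*)\bigr),$$ where $\|\cdot\|$ is the Euclidean norm and the induced operator norm. **Theorem.** Assume that $\mathcal L_\gamma$ is a KL function. Then $\Omega(w^0)\neq\emptyset$, and for every $w^*=(x_1^*,\dots,x_N^*,\lambda^*)\in\Omega(w^0)$: 1. The sequence has finite length: $\sum_{k\ge0}\Delta_k<\infty$. There are $\varepsilon>0$, $\eta$ and $\varphi$ such that $(\{w:\operatorname{dist}(w,\Omega(w^0))<\varepsilon\},\eta,\varphi)$ is admissible and $\sum_{k=0}^\infty\Delta_k\le G(\varphi)$. Moreover, every admissible $(W,\eta,\varphi)$ satisfies $\sum_{k=0}^\infty\Delta_k\le G((N+1)\varphi)$. 2. The whole sequence $(A_1x_1^k,\dots,A_{N-1}x_{N-1}^k,x_N^k,\lambda^k)$ converges to $(A_1x_1^*,\dots,A_{N-1}x_{N-1}^*,x_N^*,\lambda^*)$. -/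

import Mathlib

open Filter Topology

noncomputable section

namespace ADMMKL

/-! ### Subdifferentials and the Kurdyka–Łojasiewicz property -/

section KL

variable {E : Type*} [NormedAddCommGroup E] [InnerProductSpace ℝ E]

/-- The Fréchet (regular) subdifferential of an extended-real-valued function at `x`: `F x` is
finite and `liminf_{z → x} (F z - F x - ⟪v, z - x⟫) / ‖z - x‖ ≥ 0`. -/
def frechetSubdifferential (F : E → EReal) (x : E) : Set E :=
  {v | F x ≠ ⊤ ∧ F x ≠ ⊥ ∧ ∀ ε : ℝ, 0 < ε →
    ∀ᶠ z in 𝓝 x, F x + ((inner ℝ v (z - x) - ε * ‖z - x‖ : ℝ) : EReal) ≤ F z}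

/-- The limiting subdifferential `∂F(x)`: limits of Fréchet subgradients `vₗ` at points `zₗ → x`
with `F zₗ → F x`; empty where `F` is not finite. -/
def subdifferential (F : E → EReal) (x : E) : Set E :=
  {v | F x ≠ ⊤ ∧ F x ≠ ⊥ ∧ ∃ z g : ℕ → E,
    Tendsto z atTop (𝓝 x) ∧ Tendsto (fun l => F (z l)) atTop (𝓝 (F x)) ∧
    (∀ l, g l ∈ frechetSubdifferential F (z l)) ∧ Tendsto g atTop (𝓝 v)}

/-- The class `Φ_η`, `η ∈ (0, ∞]`, of desingularizing functions `φ : [0, η) → ℝ₊`: concave and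
continuous on `[0, η)`, `C¹` on `(0, η)`, with `φ 0 = 0` and `φ' > 0` on `(0, η)`.
Values of `φ` outside `[0, η)` are irrelevant. -/
structure IsDesingularizing (η : EReal) (φ : ℝ → ℝ) : Prop where
  eta_pos : 0 < η
  nonneg : ∀ s : ℝ, 0 ≤ s → (s : EReal) < η → 0 ≤ φ s
  concave : ConcaveOn ℝ {s : ℝ | 0 ≤ s ∧ (s : EReal) < η} φ
  continuousOn : ContinuousOn φ {s : ℝ | 0 ≤ s ∧ (s : EReal) < η}
  map_zero : φ 0 = 0
  contDiffOn : ContDiffOn ℝ 1 φ {s : ℝ | 0 < s ∧ (s : EReal) < η}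
  deriv_pos : ∀ s : ℝ, 0 < s → (s : EReal) < η → 0 < deriv φ s

/-- The inequality `φ'(F w - F w₀) · dist(0, ∂F(w)) ≥ 1` for all `w ∈ W` with
`F w₀ < F w < F w₀ + η`. The distance to the empty set is `∞`. -/
def KLInequalityOn (F : E → EReal) (w₀ : E) (W : Set E) (η : EReal) (φ : ℝ → ℝ) : Prop :=
  ∀ w ∈ W, F w₀ < F w → F w < F w₀ + η →
    1 ≤ ENNReal.ofReal (deriv φ (F w - F w₀).toReal) *
      Metric.infEDist (0 : E) (subdifferential F w)

/-- The Kurdyka–Łojasiewicz property of `F` at `w₀`. -/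
def HasKLProperty (F : E → EReal) (w₀ : E) : Prop :=
  ∃ (η : EReal) (W : Set E) (φ : ℝ → ℝ),
    W ∈ 𝓝 w₀ ∧ IsDesingularizing η φ ∧ KLInequalityOn F w₀ W η φ

/-- `F` is a KL function: it has the KL property at every point of the domain of `∂F`. -/
def IsKLFunction (F : E → EReal) : Prop :=
  ∀ w₀ : E, (subdifferential F w₀).Nonempty → HasKLProperty F w₀

/-- The set of limits of convergent subsequences. -/
def limitPoints (w : ℕ → E) : Set E :=
  {a | ∃ κ : ℕ → ℕ, StrictMono κ ∧ Tendsto (fun l => w (κ l)) atTop (𝓝 a)}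

end KL

/-! ### The multi-block problem and ADMM -/

/-- The data of the `N`-block problem with `N = m + 1` and `A_N = I`, `𝒳_N = ℝᵖ`:
minimize `∑_{i<N} f_i(x_i) + f_N(x_N)` subject to `∑_{i<N} A_i x_i + x_N = b`, `x_i ∈ 𝒳_i`.
The blocks `1, …, N - 1` are indexed by `Fin m`; the matrices `A_i` are given as linear maps. -/
structure Problem where
  m : ℕ
  p : ℕ
  n : Fin m → ℕ
  f : (i : Fin m) → EuclideanSpace ℝ (Fin (n i)) → ℝ
  X : (i : Fin m) → Set (EuclideanSpace ℝ (Fin (n i)))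
  fN : EuclideanSpace ℝ (Fin p) → ℝ
  A : (i : Fin m) → EuclideanSpace ℝ (Fin (n i)) →L[ℝ] EuclideanSpace ℝ (Fin p)
  b : EuclideanSpace ℝ (Fin p)

namespace Problem

variable (P : Problem)

/-- The space `ℝᵖ` of the constraint, of the last block `x_N` and of the multiplier `λ`. -/
abbrev V : Type := EuclideanSpace ℝ (Fin P.p)

/-- The space of `(x_1, …, x_{N-1})`, with the Euclidean norm. -/
abbrev Blocks : Type := PiLp 2 (fun i : Fin P.m => EuclideanSpace ℝ (Fin (P.n i)))

/-- The space of `w = (x_1, …, x_{N-1}, x_N, λ)`, with the Euclidean norm. -/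
abbrev Space : Type := WithLp 2 (P.Blocks × WithLp 2 (P.V × P.V))

variable {P}

/-- The block `x_i`, `i < N`, of `w`. -/
def x (w : P.Space) (i : Fin P.m) : EuclideanSpace ℝ (Fin (P.n i)) := w.fst i

/-- The last block `x_N` of `w`. -/
def xN (w : P.Space) : P.V := w.snd.fst

/-- The multiplier `λ` of `w`. -/
def lam (w : P.Space) : P.V := w.snd.snd

variable (P)

/-- `∑_{i<N} A_i x_i + x_N - b`. -/
def residual (x : (i : Fin P.m) → EuclideanSpace ℝ (Fin (P.n i))) (y : P.V) : P.V :=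
  ∑ i, P.A i (x i) + y - P.b

/-- The augmented Lagrangian
`∑ f_j(x_j) - ⟪λ, ∑ A_j x_j - b⟫ + (γ / 2) ‖∑ A_j x_j - b‖²`, with `y = x_N`. -/
def augLag (γ : ℝ) (x : (i : Fin P.m) → EuclideanSpace ℝ (Fin (P.n i))) (y l : P.V) : ℝ :=
  ∑ i, P.f i (x i) + P.fN y - inner ℝ l (P.residual x y) + γ / 2 * ‖P.residual x y‖ ^ 2

/-- The augmented Lagrangian as a function of `w`. -/
def lagr (γ : ℝ) (w : P.Space) : ℝ := P.augLag γ (x w) (xN w) (lam w)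

open Classical in
/-- The augmented Lagrangian as an extended-real-valued function, with value `+∞` outside
`𝒳_1 × ⋯ × 𝒳_{N-1} × ℝᵖ × ℝᵖ`. -/
def extLagr (γ : ℝ) (w : P.Space) : EReal :=
  if ∀ i, x w i ∈ P.X i then (P.lagr γ w : EReal) else ⊤

/-- The convexity, boundedness, coercivity and smoothness conditions on the problem, with the
condition on the penalty parameter `γ`; `L` is a Lipschitz constant of `∇f_N`. -/
structure Scenario (γ : ℝ) (L : NNReal) : Prop where
  closed_X : ∀ i, IsClosed (P.X i)
  convex_X : ∀ i, Convex ℝ (P.X i)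
  convex_f : ∀ i, ConvexOn ℝ Set.univ (P.f i)
  convex_fN : ConvexOn ℝ Set.univ P.fN
  bddBelow_f : ∀ i, BddBelow (P.f i '' P.X i)
  bddBelow_fN : BddBelow (Set.range P.fN)
  /-- `f_i + 1_{𝒳_i}` is coercive. -/
  coercive : ∀ i, Tendsto (P.f i) (Bornology.cobounded _ ⊓ 𝓟 (P.X i)) atTop
  differentiable_fN : Differentiable ℝ P.fN
  lipschitz_grad : LipschitzWith L (gradient P.fN)
  gamma_gt : √2 * (L : ℝ) < γ

/-- `(w^k)` is generated by the multi-block ADMM: the blocks `x_1, …, x_N` are updated one after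
the other, each to a minimizer over `𝒳_i` of the augmented Lagrangian in which the earlier blocks
have their new and the later blocks their old values; then the multiplier is updated. -/
structure IsADMM (γ : ℝ) (w : ℕ → P.Space) : Prop where
  x_mem : ∀ k i, x (w (k + 1)) i ∈ P.X i
  x_min : ∀ k i, IsMinOn
    (fun z => P.augLag γ
      (Function.update (fun j => if j < i then x (w (k + 1)) j else x (w k) j) i z)
      (xN (w k)) (lam (w k)))
    (P.X i) (x (w (k + 1)) i)
  xN_min : ∀ k, IsMinOn (fun z => P.augLag γ (x (w (k + 1))) z (lam (w k))) Set.univ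
    (xN (w (k + 1)))
  lam_eq : ∀ k, lam (w (k + 1)) =
    lam (w k) - γ • P.residual (x (w (k + 1))) (xN (w (k + 1)))

/-- `∑_{i<N} ‖A_i x_i - A_i x_i'‖ + ‖x_N - x_N'‖ + ‖λ - λ'‖`. -/
def gap (w w' : P.Space) : ℝ :=
  ∑ i, ‖P.A i (x w i) - P.A i (x w' i)‖ + ‖xN w - xN w'‖ + ‖lam w - lam w'‖

/-- `M = max (γ ∑_{i<N} ‖A_iᵀ‖, 1/γ + 1 + ∑_{i<N} ‖A_iᵀ‖)`, with operator norms. -/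
def constM (γ : ℝ) : ℝ :=
  max (γ * ∑ i, ‖(P.A i).adjoint‖) (1 / γ + 1 + ∑ i, ‖(P.A i).adjoint‖)

/-- `G = 2 gap(w⁰, w¹) + (2 M γ (1 + L²) / (γ² - 2 L²)) φ(ℒ(w¹) - ℒ(w*))`. -/
def constG (γ : ℝ) (L : NNReal) (w : ℕ → P.Space) (ws : P.Space) (φ : ℝ → ℝ) : ℝ :=
  2 * P.gap (w 0) (w 1) +
    2 * P.constM γ * γ * (1 + (L : ℝ) ^ 2) / (γ ^ 2 - 2 * (L : ℝ) ^ 2) *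
      φ (P.lagr γ (w 1) - P.lagr γ ws)

/-- `φ ∈ Φ_η` is a uniformized desingularizing function of the augmented Lagrangian at the level
`ℒ(w*)`, on an open set `W` that contains the limit points of `(w^k)`, and the iterates `w^k`,
`k ≥ 1`, lie in the region where it applies. -/
structure IsUniformKL (γ : ℝ) (w : ℕ → P.Space) (ws : P.Space) (W : Set P.Space)
    (η : EReal) (φ : ℝ → ℝ) : Prop where
  desing : IsDesingularizing η φ
  isOpen : IsOpen W
  limitPoints_subset : limitPoints w ⊆ W
  ineq : KLInequalityOn (P.extLagr γ) ws W η φ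
  iterate_mem : ∀ k, 1 ≤ k → w k ∈ W
  iterate_lt : ∀ k, 1 ≤ k → P.extLagr γ (w k) < P.extLagr γ ws + η

end Problem

end ADMMKL

end

/-!
Convergence of the multi-block ADMM under the Kurdyka–Łojasiewicz property.

The augmented Lagrangian `ℒ` is a convex function with closed convex domain plus a quadratic
coupling term. Its limiting subdifferential is therefore described by a single subgradient
inequality (`Scenario.mem_subdifferential_iff`), which has a closed graph
(`Scenario.isClosed_isSubgradient`).

Each block update minimizes a convex function plus `γ / 2 ‖A_i x_i + c‖²` and decreases `ℒ` by at
least `γ / 2` times the squared change of `A_i x_i`. From the second step on, `λ^k = ∇f_N(x_N^k)`, so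
the increase of `ℒ` caused by the multiplier update is at most `L² / γ` times the squared change of
`x_N`, and `γ > √2 L` leaves a net decrease (`IsADMM.sufficient_decrease`). The optimality
conditions of the updates give a subgradient of norm at most `M Δ_k` at the new iterate
(`IsADMM.exists_isSubgradient`). The descent lemma for `f_N` together with coercivity bounds the
iterates (`IsADMM.isBounded_range`), so limit points exist, and all of them are critical
(`IsADMM.isSubgradient_limit`).

A critical point of `ℒ` satisfies the optimality conditions of the underlying convex problem, so all
critical values agree (`IsSubgradient.lagr_eq_lagr`). Hence on any bounded set, however large, the
local inequalities can be patched to one with a desingularizing function defined on `[0, ∞)`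
(`Scenario.exists_klInequalityOn_of_isBounded`): near a critical point the local desingularizing
function is continued linearly (`IsDesingularizing.exists_extension`), elsewhere the subgradients
are bounded away from zero and a linear function does, and finitely many such functions are added.
In particular a neighbourhood of the limit set containing every iterate is admissible.

For an admissible `φ`, concavity turns decrease and subgradient bound into
`2 Δ_{k+1} ≤ Δ_k + C (φ (ℒ(w^{k+1}) - ℒ*) - φ (ℒ(w^{k+2}) - ℒ*))` (`IsADMM.two_mul_gap_le`), which
telescopes to the length bound (`IsADMM.sum_gap_le`). The factor `N + 1` in it comes from comparing
the square of a sum of `N + 1` norms with the sum of their squares; as `(N + 1) φ` is admissible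
along with `φ`, the existence claim holds without this factor.
-/

namespace ADMMKL

/-! ### Convex functions plus a quadratic -/

/-- First-order information is extracted along segments: the quadratic `t ↦ t a + t² b` cannot be
nonnegative for small `t > 0` unless its linear coefficient is nonnegative. -/
theorem nonneg_of_eventually_nonneg_quadratic {a b : ℝ}
    (h : ∀ᶠ t : ℝ in 𝓝[>] 0, 0 ≤ t * a + t ^ 2 * b) : 0 ≤ a := by
  have hlim : Tendsto (fun t : ℝ => a + t * b) (𝓝[>] 0) (𝓝 a) := by
    have : Tendsto (fun t : ℝ => a + t * b) (𝓝 0) (𝓝 (a + 0 * b)) := by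
      apply Continuous.tendsto; fun_prop
    simpa using this.mono_left nhdsWithin_le_nhds
  refine ge_of_tendsto hlim ?_
  filter_upwards [h, self_mem_nhdsWithin] with t ht ht0
  have ht0 : 0 < t := ht0
  have : 0 ≤ t * (a + t * b) := by nlinarith
  exact nonneg_of_mul_nonneg_right this ht0

theorem eventually_mem_Ioc_zero_one : ∀ᶠ t : ℝ in 𝓝[>] 0, 0 < t ∧ t ≤ 1 := by
  filter_upwards [self_mem_nhdsWithin,
    mem_nhdsWithin_of_mem_nhds (Iic_mem_nhds (show (0 : ℝ) < 1 by norm_num))] with t h1 h2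
  exact ⟨h1, h2⟩

section Prox

variable {E V : Type*} [NormedAddCommGroup E] [NormedSpace ℝ E]
  [NormedAddCommGroup V] [InnerProductSpace ℝ V]

/-- Second-order expansion of the augmentation term `-⟪l, r⟫ + γ / 2 ‖r‖²`. -/
theorem augmentation_add (l r h : V) (γ : ℝ) :
    -inner ℝ l (r + h) + γ / 2 * ‖r + h‖ ^ 2 =
      (-inner ℝ l r + γ / 2 * ‖r‖ ^ 2) - inner ℝ (l - γ • r) h + γ / 2 * ‖h‖ ^ 2 := by
  rw [norm_add_sq_real, inner_add_right, inner_sub_left, real_inner_smul_left]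
  ring

/-- The variational inequality of a minimizer of a convex function plus an augmentation term. -/
theorem variational_of_isMinOn {s : Set E} {f : E → ℝ} (hf : ConvexOn ℝ s f) (A : E →L[ℝ] V)
    (c l : V) (γ : ℝ) {x z : E} (hx : x ∈ s)
    (hmin : IsMinOn (fun z => f z - inner ℝ l (A z + c) + γ / 2 * ‖A z + c‖ ^ 2) s x)
    (hz : z ∈ s) :
    f x + inner ℝ (l - γ • (A x + c)) (A z - A x) ≤ f z := by
  suffices 0 ≤ f z - f x - inner ℝ (l - γ • (A x + c)) (A z - A x) by linarith
  refine nonneg_of_eventually_nonneg_quadratic (b := γ / 2 * ‖A z - A x‖ ^ 2) ?_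
  filter_upwards [eventually_mem_Ioc_zero_one] with t ⟨ht0, ht1⟩
  have h1 := hmin (hf.1 hx hz (sub_nonneg.2 ht1) ht0.le (by ring))
  have h2 := hf.2 hx hz (sub_nonneg.2 ht1) ht0.le (by ring)
  simp only [Set.mem_ofPred_eq, smul_eq_mul] at h1 h2
  have h3 : A ((1 - t) • x + t • z) + c = (A x + c) + t • (A z - A x) := by
    simp only [map_add, map_smul]; module
  have h4 := augmentation_add l (A x + c) (t • (A z - A x)) γ
  rw [h3] at h1
  rw [norm_smul, mul_pow, Real.norm_eq_abs, sq_abs, real_inner_smul_right] at h4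
  nlinarith

/-- A minimizer of a convex function plus an augmentation term beats every competitor by the
quadratic term of the augmentation. -/
theorem quadratic_growth_of_isMinOn {s : Set E} {f : E → ℝ} (hf : ConvexOn ℝ s f)
    (A : E →L[ℝ] V) (c l : V) (γ : ℝ) {x z : E} (hx : x ∈ s)
    (hmin : IsMinOn (fun z => f z - inner ℝ l (A z + c) + γ / 2 * ‖A z + c‖ ^ 2) s x)
    (hz : z ∈ s) :
    f x - inner ℝ l (A x + c) + γ / 2 * ‖A x + c‖ ^ 2 + γ / 2 * ‖A z - A x‖ ^ 2 ≤
      f z - inner ℝ l (A z + c) + γ / 2 * ‖A z + c‖ ^ 2 := by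
  have h1 := variational_of_isMinOn hf A c l γ hx hmin hz
  have h2 := augmentation_add l (A x + c) (A z - A x) γ
  rw [show A x + c + (A z - A x) = A z + c by abel] at h2
  linarith

end Prox

/-! ### Smooth convex functions -/

section Smooth

variable {V : Type*} [NormedAddCommGroup V] [InnerProductSpace ℝ V] [CompleteSpace V]

/-- A global subgradient of a differentiable function is its gradient. -/
theorem gradient_eq_of_subgradient {f : V → ℝ} {x v : V} (hf : DifferentiableAt ℝ f x)
    (h : ∀ z, f x + inner ℝ v (z - x) ≤ f z) : gradient f x = v := by
  have hmin : IsLocalMin (fun z => f z - inner ℝ v z) x := by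
    refine Eventually.of_forall fun z => ?_
    have := h z
    rw [inner_sub_right] at this
    simp only
    linarith
  have hd : HasFDerivAt (fun z => f z - inner ℝ v z)
      (InnerProductSpace.toDual ℝ V (gradient f x) - innerSL ℝ v) x :=
    hf.hasGradientAt.hasFDerivAt.sub (innerSL ℝ v).hasFDerivAt
  have h0 := hmin.hasFDerivAt_eq_zero hd
  refine ext_inner_right ℝ fun z => ?_
  have := congrArg (fun T : V →L[ℝ] ℝ => T z) h0
  simp only [sub_apply, InnerProductSpace.toDual_apply_apply,
    innerSL_apply_apply, zero_apply] at this
  linarith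

/-- The descent lemma: a function with `L`-Lipschitz gradient lies below its quadratic upper
model. -/
theorem le_quadratic_of_lipschitzWith_gradient {f : V → ℝ} {L : NNReal}
    (hf : Differentiable ℝ f) (hL : LipschitzWith L (gradient f)) (x h : V) :
    f (x + h) ≤ f x + inner ℝ (gradient f x) h + (L : ℝ) / 2 * ‖h‖ ^ 2 := by
  set g : ℝ → ℝ := fun t => f (x + t • h) - t * inner ℝ (gradient f x) h
    - (L : ℝ) / 2 * ‖h‖ ^ 2 * t ^ 2 with hg
  have hder : ∀ t, HasDerivAt g (inner ℝ (gradient f (x + t • h)) h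
      - inner ℝ (gradient f x) h - (L : ℝ) / 2 * ‖h‖ ^ 2 * (2 * t)) t := by
    intro t
    have h1 : HasDerivAt (fun t : ℝ => x + t • h) h t := by
      simpa using ((hasDerivAt_id t).smul_const h).const_add x
    have h2 : HasDerivAt (fun t : ℝ => f (x + t • h)) (inner ℝ (gradient f (x + t • h)) h) t := by
      have := ((hf (x + t • h)).hasGradientAt.hasFDerivAt).comp_hasDerivAt t h1
      rw [InnerProductSpace.toDual_apply_apply] at this
      exact this
    have h3 : HasDerivAt (fun t : ℝ => t * inner ℝ (gradient f x) h)
        (inner ℝ (gradient f x) h) t := by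
      simpa using (hasDerivAt_id t).mul_const (inner ℝ (gradient f x) h)
    have h4 : HasDerivAt (fun t : ℝ => (L : ℝ) / 2 * ‖h‖ ^ 2 * t ^ 2)
        ((L : ℝ) / 2 * ‖h‖ ^ 2 * (2 * t)) t := by
      simpa using (hasDerivAt_pow 2 t).const_mul ((L : ℝ) / 2 * ‖h‖ ^ 2)
    exact (h2.sub h3).sub h4
  have hanti : AntitoneOn g (Set.Icc 0 1) := by
    refine antitoneOn_of_deriv_nonpos (convex_Icc 0 1)
      (fun t _ => (hder t).continuousAt.continuousWithinAt)
      (fun t _ => (hder t).differentiableAt.differentiableWithinAt) fun t ht => ?_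
    rw [interior_Icc] at ht
    rw [(hder t).deriv, ← inner_sub_left]
    have h1 : inner ℝ (gradient f (x + t • h) - gradient f x) h ≤ (L * (t * ‖h‖)) * ‖h‖ := by
      refine (real_inner_le_norm _ _).trans (mul_le_mul_of_nonneg_right ?_ (norm_nonneg _))
      have := hL.dist_le_mul (x + t • h) x
      rwa [dist_eq_norm, dist_eq_norm, add_sub_cancel_left, norm_smul, Real.norm_eq_abs,
        abs_of_pos ht.1] at this
    nlinarith
  have := hanti (Set.left_mem_Icc.2 zero_le_one) (Set.right_mem_Icc.2 zero_le_one) zero_le_one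
  simp only [hg, one_smul, zero_smul, add_zero] at this
  linarith

end Smooth

/-! ### Desingularizing functions -/

theorem setOf_nonneg_and_lt_top : {s : ℝ | 0 ≤ s ∧ (s : EReal) < ⊤} = Set.Ici 0 := by
  ext s; simp [EReal.coe_lt_top]

theorem setOf_pos_and_lt_top : {s : ℝ | 0 < s ∧ (s : EReal) < ⊤} = Set.Ioi 0 := by
  ext s; simp [EReal.coe_lt_top]

theorem isOpen_setOf_pos_and_lt (η : EReal) : IsOpen {s : ℝ | 0 < s ∧ (s : EReal) < η} :=
  isOpen_Ioi.inter (isOpen_Iio.preimage continuous_coe_real_ereal)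

namespace IsDesingularizing

variable {η : EReal} {φ ψ : ℝ → ℝ}

theorem differentiableAt (h : IsDesingularizing η φ) {s : ℝ} (hs : 0 < s) (hη : (s : EReal) < η) :
    DifferentiableAt ℝ φ s :=
  (h.contDiffOn.differentiableOn one_ne_zero).differentiableAt
    ((isOpen_setOf_pos_and_lt η).mem_nhds ⟨hs, hη⟩)

theorem linear {a : ℝ} (ha : 0 < a) : IsDesingularizing ⊤ (fun s => a * s) where
  eta_pos := EReal.coe_lt_top 0
  nonneg s hs _ := by positivity
  concave := by
    rw [setOf_nonneg_and_lt_top]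
    exact (((LinearMap.mul ℝ ℝ) a).concaveOn (convex_Ici 0))
  continuousOn := by fun_prop
  map_zero := by simp
  contDiffOn := by fun_prop
  deriv_pos s _ _ := by simpa using ha

theorem const_mul (h : IsDesingularizing η φ) {a : ℝ} (ha : 0 < a) :
    IsDesingularizing η (fun s => a * φ s) where
  eta_pos := h.eta_pos
  nonneg s hs hη := mul_nonneg ha.le (h.nonneg s hs hη)
  concave := h.concave.smul ha.le
  continuousOn := h.continuousOn.const_mul a
  map_zero := by simp [h.map_zero]
  contDiffOn := contDiffOn_const.mul h.contDiffOn
  deriv_pos s hs hη := by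
    rw [deriv_const_mul_field]
    exact mul_pos ha (h.deriv_pos s hs hη)

theorem add (h : IsDesingularizing η φ) (h' : IsDesingularizing η ψ) :
    IsDesingularizing η (fun s => φ s + ψ s) where
  eta_pos := h.eta_pos
  nonneg s hs hη := add_nonneg (h.nonneg s hs hη) (h'.nonneg s hs hη)
  concave := h.concave.add h'.concave
  continuousOn := h.continuousOn.add h'.continuousOn
  map_zero := by simp [h.map_zero, h'.map_zero]
  contDiffOn := h.contDiffOn.add h'.contDiffOn
  deriv_pos s hs hη := by
    rw [deriv_fun_add (h.differentiableAt hs hη) (h'.differentiableAt hs hη)]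
    exact add_pos (h.deriv_pos s hs hη) (h'.deriv_pos s hs hη)

theorem le_sub_of_concave (h : IsDesingularizing η φ) {s t : ℝ} (hs : 0 < s)
    (hη : (s : EReal) < η) (ht : 0 ≤ t) (hts : t ≤ s) :
    deriv φ s * (s - t) ≤ φ s - φ t := by
  rcases hts.eq_or_lt with rfl | hts
  · simp
  have := h.concave.le_slope_of_hasDerivAt (x := t) (y := s)
    ⟨ht, (EReal.coe_lt_coe_iff.2 hts).trans hη⟩ ⟨hs.le, hη⟩ hts
    (h.differentiableAt hs hη).hasDerivAt
  rwa [slope_def_field, le_div_iff₀ (sub_pos.2 hts)] at this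

theorem antitoneOn_deriv (h : IsDesingularizing η φ) :
    AntitoneOn (deriv φ) {s : ℝ | 0 < s ∧ (s : EReal) < η} := by
  intro s hs t ht hst
  rcases hst.eq_or_lt with rfl | hlt
  · rfl
  have h1 := h.concave.le_slope_of_hasDerivAt (x := s) (y := t) ⟨hs.1.le, hs.2⟩
    ⟨ht.1.le, ht.2⟩ hlt (h.differentiableAt ht.1 ht.2).hasDerivAt
  have h2 := h.concave.slope_le_of_hasDerivAt (x := s) (y := t) ⟨hs.1.le, hs.2⟩
    ⟨ht.1.le, ht.2⟩ hlt (h.differentiableAt hs.1 hs.2).hasDerivAt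
  exact h1.trans h2

/-- A desingularizing function can be continued linearly beyond any point `a` of its domain to one
on `[0, ∞)`: concavity and the `C¹` property survive because the slopes agree at `a`. -/
theorem exists_extension (h : IsDesingularizing η φ) {a : ℝ} (ha : 0 < a)
    (haη : (a : EReal) < η) :
    ∃ ψ : ℝ → ℝ, IsDesingularizing ⊤ ψ ∧ ∀ s, 0 < s → s ≤ a → deriv ψ s = deriv φ s := by
  set ψ : ℝ → ℝ := fun s => if s ≤ a then φ s else φ a + deriv φ a * (s - a) with hψ
  have hle : ∀ s, s ≤ a → ψ s = φ s := fun s hs => by simp [hψ, hs]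
  have hge : ∀ s, a ≤ s → ψ s = φ a + deriv φ a * (s - a) := fun s hs => by
    rcases hs.eq_or_lt with rfl | hs
    · simp [hψ]
    · simp [hψ, not_le.2 hs]
  have hmem : ∀ s, s ≤ a → (s : EReal) < η := fun s hs =>
    (EReal.coe_le_coe_iff.2 hs).trans_lt haη
  have hlin : ∀ s, HasDerivAt (fun s => φ a + deriv φ a * (s - a)) (deriv φ a) s := fun s => by
    simpa using (((hasDerivAt_id s).sub_const a).const_mul (deriv φ a)).const_add (φ a)
  have hder : ∀ s, 0 < s → HasDerivAt ψ (deriv φ (min s a)) s := by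
    intro s hs
    rcases lt_trichotomy s a with hsa | rfl | hsa
    · rw [min_eq_left hsa.le]
      refine (h.differentiableAt hs (hmem s hsa.le)).hasDerivAt.congr_of_eventuallyEq ?_
      filter_upwards [Iio_mem_nhds hsa] with t ht using hle t (le_of_lt ht)
    · rw [min_self, ← hasDerivWithinAt_univ, ← Set.Iic_union_Ici (a := s)]
      refine HasDerivWithinAt.union ?_ ?_
      · exact (h.differentiableAt hs haη).hasDerivAt.hasDerivWithinAt.congr
          (fun t ht => hle t ht) (hle s le_rfl)
      · exact (hlin s).hasDerivWithinAt.congr (fun t ht => hge t ht) (hge s le_rfl)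
    · rw [min_eq_right hsa.le]
      refine (hlin s).congr_of_eventuallyEq ?_
      filter_upwards [Ioi_mem_nhds hsa] with t ht using hge t (le_of_lt ht)
  have hminmem : ∀ s : ℝ, 0 < s → min s a ∈ {s : ℝ | 0 < s ∧ (s : EReal) < η} := fun s hs =>
    ⟨lt_min hs ha, hmem _ (min_le_right s a)⟩
  have hpos : ∀ s, 0 < s → 0 < deriv ψ s := fun s hs => by
    rw [(hder s hs).deriv]
    exact h.deriv_pos _ (hminmem s hs).1 (hminmem s hs).2
  have hcont : ContinuousOn ψ (Set.Ici 0) := by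
    intro s hs
    rcases (Set.mem_Ici.1 hs).eq_or_lt with rfl | hs
    · have h0 : ContinuousWithinAt φ (Set.Icc 0 a) 0 :=
        (h.continuousOn 0 ⟨le_rfl, hmem 0 ha.le⟩).mono fun t ht => ⟨ht.1, hmem t ht.2⟩
      have h1 : ContinuousWithinAt ψ (Set.Icc 0 a) 0 :=
        h0.congr (fun t ht => hle t ht.2) (hle 0 ha.le)
      exact h1.mono_of_mem_nhdsWithin (Icc_mem_nhdsGE ha)
    · exact (hder s hs).continuousAt.continuousWithinAt
  have hmono : MonotoneOn ψ (Set.Ici 0) := by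
    refine monotoneOn_of_deriv_nonneg (convex_Ici 0) hcont ?_ ?_
    · rw [interior_Ici]
      exact fun s hs => (hder s hs).differentiableAt.differentiableWithinAt
    · rw [interior_Ici]
      exact fun s hs => (hpos s hs).le
  have hzero : ψ 0 = 0 := by rw [hle 0 ha.le, h.map_zero]
  refine ⟨ψ, ⟨EReal.coe_lt_top 0, fun s hs _ => ?_, ?_, ?_, hzero, ?_, fun s hs _ => hpos s hs⟩,
    fun s hs hsa => ?_⟩
  · rw [← hzero]
    exact hmono Set.self_mem_Ici hs hs
  · rw [setOf_nonneg_and_lt_top]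
    refine AntitoneOn.concaveOn_of_deriv (convex_Ici 0) hcont ?_ ?_ <;> rw [interior_Ici]
    · exact fun s hs => (hder s hs).differentiableAt.differentiableWithinAt
    · intro s hs t ht hst
      rw [(hder s hs).deriv, (hder t ht).deriv]
      exact h.antitoneOn_deriv (hminmem s hs) (hminmem t ht) (min_le_min_right a hst)
  · rwa [setOf_nonneg_and_lt_top]
  · rw [setOf_pos_and_lt_top]
    have hd : ContinuousOn (deriv φ) {s : ℝ | 0 < s ∧ (s : EReal) < η} :=
      h.contDiffOn.continuousOn_deriv_of_isOpen (isOpen_setOf_pos_and_lt η) le_rfl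
    rw [show (1 : WithTop ℕ∞) = 0 + 1 by norm_num, contDiffOn_succ_iff_deriv_of_isOpen isOpen_Ioi]
    refine ⟨fun s hs => (hder s hs).differentiableAt.differentiableWithinAt, by simp, ?_⟩
    rw [contDiffOn_zero]
    refine ContinuousOn.congr (f := fun s => deriv φ (min s a)) ?_ fun s hs => (hder s hs).deriv
    exact hd.comp (by fun_prop) fun s hs => hminmem s hs
  · rw [(hder s hs).deriv, min_eq_left hsa]

end IsDesingularizing

namespace Problem

variable (P : Problem)

/-! ### The subdifferential of the augmented Lagrangian -/

/-- The domain `𝒳_1 × ⋯ × 𝒳_{N-1} × ℝᵖ × ℝᵖ` of the extended augmented Lagrangian. -/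
def dom : Set P.Space := {w | ∀ i, x w i ∈ P.X i}

/-- The objective `∑ f_i(x_i) + f_N(x_N)`. -/
def objective (w : P.Space) : ℝ := ∑ i, P.f i (x w i) + P.fN (xN w)

/-- The projection of `w` to the block `x_i`. -/
noncomputable def blockL (i : Fin P.m) : P.Space →L[ℝ] EuclideanSpace ℝ (Fin (P.n i)) :=
  (PiLp.proj 2 (fun i : Fin P.m => EuclideanSpace ℝ (Fin (P.n i))) i).comp
    (WithLp.fstL 2 ℝ P.Blocks (WithLp 2 (P.V × P.V)))

/-- The projection of `w` to `x_N`. -/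
noncomputable def xNL : P.Space →L[ℝ] P.V :=
  (WithLp.fstL 2 ℝ P.V P.V).comp (WithLp.sndL 2 ℝ P.Blocks (WithLp 2 (P.V × P.V)))

/-- The projection of `w` to the multiplier. -/
noncomputable def lamL : P.Space →L[ℝ] P.V :=
  (WithLp.sndL 2 ℝ P.V P.V).comp (WithLp.sndL 2 ℝ P.Blocks (WithLp 2 (P.V × P.V)))

/-- The linear part `w ↦ ∑ A_i x_i + x_N` of the constraint. -/
noncomputable def constraintL : P.Space →L[ℝ] P.V := ∑ i, (P.A i).comp (P.blockL i) + P.xNL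

variable {P}

theorem blockL_apply (i : Fin P.m) (w : P.Space) : P.blockL i w = x w i := rfl

theorem xNL_apply (w : P.Space) : P.xNL w = xN w := rfl

theorem lamL_apply (w : P.Space) : P.lamL w = lam w := rfl

theorem constraintL_apply (w : P.Space) : P.constraintL w = ∑ i, P.A i (x w i) + xN w := by
  simp only [constraintL, add_apply, sum_apply, ContinuousLinearMap.comp_apply, blockL_apply,
    xNL_apply]

theorem residual_eq (w : P.Space) : P.residual (x w) (xN w) = P.constraintL w - P.b := by
  rw [residual, constraintL_apply]

theorem continuous_x (i : Fin P.m) : Continuous fun w : P.Space => x w i := (P.blockL i).continuous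

theorem continuous_xN : Continuous fun w : P.Space => xN w := P.xNL.continuous

theorem continuous_lam : Continuous fun w : P.Space => lam w := P.lamL.continuous

theorem inner_space (v h : P.Space) :
    inner ℝ v h = ∑ i, inner ℝ (x v i) (x h i) + inner ℝ (xN v) (xN h) + inner ℝ (lam v) (lam h) := by
  rw [WithLp.prod_inner_apply, WithLp.prod_inner_apply, PiLp.inner_apply, add_assoc]
  rfl

theorem norm_sq_space (v : P.Space) :
    ‖v‖ ^ 2 = ∑ i, ‖x v i‖ ^ 2 + ‖xN v‖ ^ 2 + ‖lam v‖ ^ 2 := by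
  simp only [← real_inner_self_eq_norm_sq]
  exact inner_space v v

theorem norm_space_le (v : P.Space) : ‖v‖ ≤ ∑ i, ‖x v i‖ + ‖xN v‖ + ‖lam v‖ := by
  have hs : 0 ≤ ∑ i, ‖x v i‖ := Finset.sum_nonneg fun i _ => norm_nonneg _
  refine le_of_sq_le_sq ?_ (by positivity)
  have h1 : ∑ i, ‖x v i‖ ^ 2 ≤ (∑ i, ‖x v i‖) ^ 2 :=
    Finset.sum_sq_le_sq_sum_of_nonneg fun i _ => norm_nonneg _
  have h2 := mul_nonneg hs (norm_nonneg (xN v))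
  have h3 := mul_nonneg hs (norm_nonneg (lam v))
  have h4 := mul_nonneg (norm_nonneg (xN v)) (norm_nonneg (lam v))
  rw [norm_sq_space]
  nlinarith

theorem objective_combo_le (hf : ∀ i, ConvexOn ℝ Set.univ (P.f i))
    (hN : ConvexOn ℝ Set.univ P.fN) (w w' : P.Space) {t : ℝ} (ht0 : 0 ≤ t) (ht1 : t ≤ 1) :
    P.objective (w + t • (w' - w)) ≤
      P.objective w + t * (P.objective w' - P.objective w) := by
  have h1 : ∀ i, P.f i (x (w + t • (w' - w)) i) ≤
      (1 - t) * P.f i (x w i) + t * P.f i (x w' i) := fun i => by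
    have := (hf i).2 (Set.mem_univ (x w i)) (Set.mem_univ (x w' i)) (sub_nonneg.2 ht1) ht0 (by ring)
    rwa [show (1 - t) • x w i + t • x w' i = x (w + t • (w' - w)) i by
      simp only [← blockL_apply, map_add, map_smul, map_sub]; module] at this
  have h2 : P.fN (xN (w + t • (w' - w))) ≤ (1 - t) * P.fN (xN w) + t * P.fN (xN w') := by
    have := hN.2 (Set.mem_univ (xN w)) (Set.mem_univ (xN w')) (sub_nonneg.2 ht1) ht0 (by ring)
    rwa [show (1 - t) • xN w + t • xN w' = xN (w + t • (w' - w)) by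
      simp only [← xNL_apply, map_add, map_smul, map_sub]; module] at this
  have h3 := Finset.sum_le_sum fun i (_ : i ∈ Finset.univ) => h1 i
  rw [Finset.sum_add_distrib, ← Finset.mul_sum, ← Finset.mul_sum] at h3
  simp only [objective]
  linarith

variable (P) in
/-- The derivative at `w`, in direction `h`, of the quadratic coupling term
`-⟪λ, r⟫ + γ / 2 ‖r‖²` of the augmented Lagrangian. -/
noncomputable def couplingDeriv (γ : ℝ) (w h : P.Space) : ℝ :=
  inner ℝ (γ • (P.constraintL w - P.b) - lam w) (P.constraintL h)
    - inner ℝ (lam h) (P.constraintL w - P.b)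

theorem lagr_eq (γ : ℝ) (w : P.Space) : P.lagr γ w = P.objective w
    - inner ℝ (lam w) (P.constraintL w - P.b) + γ / 2 * ‖P.constraintL w - P.b‖ ^ 2 := by
  rw [lagr, augLag, residual_eq, objective]

/-- The exact second-order expansion of the augmented Lagrangian; only the objective is not
expanded. -/
theorem lagr_add (γ : ℝ) (w h : P.Space) :
    P.lagr γ (w + h) = P.lagr γ w + (P.objective (w + h) - P.objective w)
      + P.couplingDeriv γ w h
      + (γ / 2 * ‖P.constraintL h‖ ^ 2 - inner ℝ (lam h) (P.constraintL h)) := by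
  rw [lagr_eq, lagr_eq, couplingDeriv,
    show P.constraintL (w + h) - P.b = (P.constraintL w - P.b) + P.constraintL h by
      rw [map_add]; abel,
    show lam (w + h) = lam w + lam h from rfl]
  generalize P.constraintL w - P.b = r
  rw [norm_add_sq_real, inner_add_left, inner_add_right, inner_add_right, inner_sub_left,
    real_inner_smul_left]
  ring

variable (P) in
/-- `v` is a subgradient of the augmented Lagrangian at `w ∈ dom`, in the sense of convex analysis:
`v` minus the gradient of the coupling term is a subgradient of the convex function
`objective + 1_dom`. -/
def IsSubgradient (γ : ℝ) (w v : P.Space) : Prop :=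
  w ∈ P.dom ∧ ∀ w' ∈ P.dom,
    P.objective w + inner ℝ v (w' - w) ≤ P.objective w' + P.couplingDeriv γ w (w' - w)

theorem extLagr_of_mem (γ : ℝ) {w : P.Space} (hw : w ∈ P.dom) :
    P.extLagr γ w = (P.lagr γ w : EReal) := by
  classical
  exact if_pos hw

theorem extLagr_of_notMem (γ : ℝ) {w : P.Space} (hw : w ∉ P.dom) : P.extLagr γ w = ⊤ := by
  classical
  exact if_neg hw

theorem extLagr_ne_bot (γ : ℝ) (w : P.Space) : P.extLagr γ w ≠ ⊥ := by
  by_cases hw : w ∈ P.dom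
  · simp [extLagr_of_mem γ hw]
  · simp [extLagr_of_notMem γ hw]

theorem extLagr_ne_top_iff (γ : ℝ) (w : P.Space) : P.extLagr γ w ≠ ⊤ ↔ w ∈ P.dom := by
  by_cases hw : w ∈ P.dom
  · simp [extLagr_of_mem γ hw, hw]
  · simp [extLagr_of_notMem γ hw, hw]

namespace Scenario

variable {γ : ℝ} {L : NNReal}

theorem gamma_pos (hP : P.Scenario γ L) : 0 < γ :=
  lt_of_le_of_lt (by positivity) hP.gamma_gt

theorem two_mul_sq_lt (hP : P.Scenario γ L) : 2 * (L : ℝ) ^ 2 < γ ^ 2 := by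
  have h := pow_lt_pow_left₀ hP.gamma_gt (by positivity) two_ne_zero
  rwa [mul_pow, Real.sq_sqrt zero_le_two] at h

theorem isClosed_dom (hP : P.Scenario γ L) : IsClosed P.dom := by
  simp only [dom, Set.ofPred_forall]
  exact isClosed_iInter fun i => (hP.closed_X i).preimage (continuous_x i)

theorem segment_mem_dom (hP : P.Scenario γ L) {w w' : P.Space} (hw : w ∈ P.dom) (hw' : w' ∈ P.dom)
    {t : ℝ} (ht0 : 0 ≤ t) (ht1 : t ≤ 1) : w + t • (w' - w) ∈ P.dom := fun i =>
  (hP.convex_X i).add_smul_sub_mem (hw i) (hw' i) ⟨ht0, ht1⟩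

theorem continuous_objective (hP : P.Scenario γ L) : Continuous P.objective := by
  have hf : ∀ i, Continuous (P.f i) := fun i => (hP.convex_f i).locallyLipschitz.continuous
  have hN : Continuous P.fN := hP.differentiable_fN.continuous
  exact (continuous_finsetSum _ fun i _ => (hf i).comp (continuous_x i)).add (hN.comp continuous_xN)

theorem continuous_lagr (hP : P.Scenario γ L) : Continuous (P.lagr γ) := by
  have h1 := hP.continuous_objective
  have h2 := continuous_lam (P := P)
  have h3 : Continuous fun w => P.constraintL w - P.b := by fun_prop
  simp_rw [funext (lagr_eq γ)]
  exact (h1.sub (h2.inner h3)).add ((h3.norm.pow 2).const_mul _)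

theorem isClosed_isSubgradient (hP : P.Scenario γ L) :
    IsClosed {q : P.Space × P.Space | P.IsSubgradient γ q.1 q.2} := by
  have h1 := hP.continuous_objective
  have h2 := continuous_lam (P := P)
  simp only [IsSubgradient, Set.ofPred_and, Set.ofPred_forall]
  refine (hP.isClosed_dom.preimage continuous_fst).inter ?_
  refine isClosed_iInter fun w' => isClosed_iInter fun _ => isClosed_le ?_ ?_
  · exact (h1.comp continuous_fst).add (continuous_snd.inner (continuous_const.sub continuous_fst))
  · unfold couplingDeriv
    refine continuous_const.add (Continuous.sub (Continuous.inner ?_ ?_) (Continuous.inner ?_ ?_))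
    · exact ((by fun_prop : Continuous fun q : P.Space × P.Space =>
        γ • (P.constraintL q.1 - P.b))).sub (h2.comp continuous_fst)
    · fun_prop
    · exact h2.comp (continuous_const.sub continuous_fst)
    · fun_prop

/-- Along the segment from `w` to `w'` the Fréchet inequality reads
`0 ≤ t (a + ε ‖w' - w‖) + O(t²)`, where `a` is the slack of the subgradient inequality. -/
theorem isSubgradient_of_mem_frechet (hP : P.Scenario γ L) {w v : P.Space}
    (hv : v ∈ frechetSubdifferential (P.extLagr γ) w) : P.IsSubgradient γ w v := by
  obtain ⟨htop, -, hv⟩ := hv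
  have hw : w ∈ P.dom := (extLagr_ne_top_iff γ w).1 htop
  refine ⟨hw, fun w' hw' => ?_⟩
  set h := w' - w with hh
  set a := P.objective w' - P.objective w + P.couplingDeriv γ w h - inner ℝ v h with ha
  suffices 0 ≤ a by linarith
  have key : ∀ ε : ℝ, 0 < ε → 0 ≤ a + ε * ‖h‖ := by
    intro ε hε
    refine nonneg_of_eventually_nonneg_quadratic
      (b := γ / 2 * ‖P.constraintL h‖ ^ 2 - inner ℝ (lam h) (P.constraintL h)) ?_
    have hlim : Tendsto (fun t : ℝ => w + t • h) (𝓝[>] 0) (𝓝 w) := by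
      have : Tendsto (fun t : ℝ => w + t • h) (𝓝 0) (𝓝 (w + (0 : ℝ) • h)) := by
        apply Continuous.tendsto; fun_prop
      simpa using this.mono_left nhdsWithin_le_nhds
    filter_upwards [hlim.eventually (hv ε hε), eventually_mem_Ioc_zero_one] with t ht ⟨ht0, ht1⟩
    rw [extLagr_of_mem γ hw, extLagr_of_mem γ (hP.segment_mem_dom hw hw' ht0.le ht1),
      ← EReal.coe_add, EReal.coe_le_coe_iff, lagr_add] at ht
    have hobj := objective_combo_le hP.convex_f hP.convex_fN w w' ht0.le ht1
    have e1 : P.couplingDeriv γ w (t • h) = t * P.couplingDeriv γ w h := by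
      simp only [couplingDeriv, ← lamL_apply, map_smul, real_inner_smul_left,
        real_inner_smul_right]
      ring
    have e2 : γ / 2 * ‖P.constraintL (t • h)‖ ^ 2
        - inner ℝ (lam (t • h)) (P.constraintL (t • h)) =
        t ^ 2 * (γ / 2 * ‖P.constraintL h‖ ^ 2 - inner ℝ (lam h) (P.constraintL h)) := by
      simp only [← lamL_apply, map_smul, real_inner_smul_left, real_inner_smul_right, norm_smul,
        mul_pow, Real.norm_eq_abs, sq_abs]
      ring
    rw [e1, e2, add_sub_cancel_left, real_inner_smul_right, norm_smul, Real.norm_eq_abs,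
      abs_of_pos ht0] at ht
    rw [← hh] at hobj
    linarith
  refine nonneg_of_eventually_nonneg_quadratic (b := ‖h‖) ?_
  filter_upwards [self_mem_nhdsWithin] with t ht
  have ht : 0 < t := ht
  have := mul_nonneg ht.le (key t ht)
  linarith

theorem mem_frechet_of_isSubgradient (hP : P.Scenario γ L) {w v : P.Space}
    (hv : P.IsSubgradient γ w v) : v ∈ frechetSubdifferential (P.extLagr γ) w := by
  obtain ⟨hw, hv⟩ := hv
  refine ⟨(extLagr_ne_top_iff γ w).2 hw, extLagr_ne_bot γ w, fun ε hε => ?_⟩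
  set C := ‖P.lamL‖ * ‖P.constraintL‖ with hC
  have hC0 : 0 ≤ C := by positivity
  filter_upwards [Metric.ball_mem_nhds w (show 0 < ε / (C + 1) by positivity)] with z hz
  by_cases hzd : z ∈ P.dom
  swap
  · rw [extLagr_of_notMem γ hzd]; exact le_top
  rw [extLagr_of_mem γ hw, extLagr_of_mem γ hzd, ← EReal.coe_add, EReal.coe_le_coe_iff]
  have h1 := lagr_add γ w (z - w)
  rw [add_sub_cancel] at h1
  have h2 := hv z hzd
  -- The remainder `⟪λ, A h⟫` is quadratic in `h = z - w`, hence at most `ε ‖h‖` near `w`.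
  have h3 : inner ℝ (lam (z - w)) (P.constraintL (z - w)) ≤ ε * ‖z - w‖ := by
    have b1 : ‖lam (z - w)‖ ≤ ‖P.lamL‖ * ‖z - w‖ := P.lamL.le_opNorm (z - w)
    have b2 := P.constraintL.le_opNorm (z - w)
    have b3 : (C + 1) * ‖z - w‖ ≤ ε := by
      rw [Metric.mem_ball, dist_eq_norm, lt_div_iff₀ (by positivity)] at hz
      linarith
    calc inner ℝ (lam (z - w)) (P.constraintL (z - w))
        ≤ ‖lam (z - w)‖ * ‖P.constraintL (z - w)‖ := real_inner_le_norm _ _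
      _ ≤ (‖P.lamL‖ * ‖z - w‖) * (‖P.constraintL‖ * ‖z - w‖) := by gcongr
      _ = (C * ‖z - w‖) * ‖z - w‖ := by rw [hC]; ring
      _ ≤ ε * ‖z - w‖ := by
        gcongr
        linarith [norm_nonneg (z - w)]
  have h4 : 0 ≤ γ / 2 * ‖P.constraintL (z - w)‖ ^ 2 := by
    have := hP.gamma_pos; positivity
  linarith

/-- The augmented Lagrangian is convex plus quadratic, so its limiting subdifferential is given by
the subgradient inequality; in particular it has a closed graph. -/
theorem mem_subdifferential_iff (hP : P.Scenario γ L) {w v : P.Space} :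
    v ∈ subdifferential (P.extLagr γ) w ↔ P.IsSubgradient γ w v := by
  constructor
  · rintro ⟨-, -, z, g, hz, -, hg, hgv⟩
    exact hP.isClosed_isSubgradient.mem_of_tendsto (hz.prodMk_nhds hgv)
      (Eventually.of_forall fun l => hP.isSubgradient_of_mem_frechet (hg l))
  · intro hv
    exact ⟨(extLagr_ne_top_iff γ w).2 hv.1, extLagr_ne_bot γ w, fun _ => w, fun _ => v,
      tendsto_const_nhds, tendsto_const_nhds, fun _ => hP.mem_frechet_of_isSubgradient hv,
      tendsto_const_nhds⟩

end Scenario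

/-! ### Critical points and the Kurdyka–Łojasiewicz inequality on bounded sets -/

section Critical

variable {γ : ℝ} {L : NNReal}

/-- The `λ`-component of a vanishing subgradient is the constraint residual. -/
theorem IsSubgradient.residual_eq_zero {w : P.Space} (hw : P.IsSubgradient γ w 0) :
    P.constraintL w - P.b = 0 := by
  set r := P.constraintL w - P.b with hr
  set e : P.Space := WithLp.toLp 2 (0, WithLp.toLp 2 (0, r)) with he
  have hx : ∀ i, x e i = 0 := fun i => rfl
  have hxN : xN e = 0 := rfl
  have hlam : lam e = r := rfl
  have hxe : ∀ i, x (w + e) i = x w i := fun i => by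
    rw [← blockL_apply, map_add, blockL_apply, blockL_apply, hx, add_zero]
  have hxNe : xN (w + e) = xN w := by
    rw [← xNL_apply, map_add, xNL_apply, xNL_apply, hxN, add_zero]
  have h := hw.2 (w + e) fun i => by rw [hxe]; exact hw.1 i
  have hobj : P.objective (w + e) = P.objective w := by simp only [objective, hxe, hxNe]
  have hce : P.constraintL e = 0 := by simp [constraintL_apply, hx, hxN]
  rw [hobj, add_sub_cancel_left, inner_zero_left, couplingDeriv, hce, inner_zero_right, hlam,
    ← hr, real_inner_self_eq_norm_sq] at h
  have : ‖r‖ ^ 2 ≤ 0 := by linarith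
  exact norm_eq_zero.1 (pow_eq_zero_iff two_ne_zero |>.1 (le_antisymm this (sq_nonneg _)))

/-- A critical point satisfies the optimality conditions of the convex problem, hence has the least
objective among all feasible points. -/
theorem IsSubgradient.objective_le {w w' : P.Space} (hw : P.IsSubgradient γ w 0)
    (hw' : w' ∈ P.dom) (hr' : P.constraintL w' - P.b = 0) : P.objective w ≤ P.objective w' := by
  have hr := hw.residual_eq_zero
  have h := hw.2 w' hw'
  have hA : P.constraintL (w' - w) = 0 := by
    rw [map_sub, sub_eq_zero.1 hr, sub_eq_zero.1 hr', sub_self]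
  rw [couplingDeriv, hr, hA] at h
  simpa using h

theorem IsSubgradient.lagr_eq_lagr {w w' : P.Space} (hw : P.IsSubgradient γ w 0)
    (hw' : P.IsSubgradient γ w' 0) : P.lagr γ w = P.lagr γ w' := by
  have h1 := hw.objective_le hw'.1 hw'.residual_eq_zero
  have h2 := hw'.objective_le hw.1 hw.residual_eq_zero
  rw [lagr_eq, lagr_eq, hw.residual_eq_zero, hw'.residual_eq_zero]
  simpa using le_antisymm h1 h2

/-- Away from critical points the subgradients are bounded away from zero, and a linear function
desingularizes. -/
theorem Scenario.exists_linear_klInequalityOn (hP : P.Scenario γ L) (ws : P.Space) {w : P.Space}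
    (hw : ¬ P.IsSubgradient γ w 0) :
    ∃ U ∈ 𝓝 w, ∃ φ, IsDesingularizing ⊤ φ ∧ KLInequalityOn (P.extLagr γ) ws U ⊤ φ := by
  have hopen : {q : P.Space × P.Space | P.IsSubgradient γ q.1 q.2}ᶜ ∈ 𝓝 (w, (0 : P.Space)) :=
    hP.isClosed_isSubgradient.isOpen_compl.mem_nhds hw
  rw [nhds_prod_eq] at hopen
  obtain ⟨U, hU, U', hU', hsub⟩ := mem_prod_iff.1 hopen
  obtain ⟨c, hc, hball⟩ := Metric.mem_nhds_iff.1 hU'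
  refine ⟨U, hU, fun s => 1 / c * s, .linear (by positivity), fun z hz _ _ => ?_⟩
  have hdist : ENNReal.ofReal c ≤ Metric.infEDist 0 (subdifferential (P.extLagr γ) z) := by
    refine Metric.le_infEDist.2 fun v hv => ?_
    rw [edist_dist]
    refine ENNReal.ofReal_le_ofReal (not_lt.1 fun hlt => ?_)
    exact hsub (Set.mk_mem_prod hz (hball (Metric.mem_ball'.2 hlt)))
      (hP.mem_subdifferential_iff.1 hv)
  have hd : deriv (fun s : ℝ => 1 / c * s) = fun _ => 1 / c := by
    funext s; simp
  rw [hd]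
  calc (1 : ENNReal) = ENNReal.ofReal (1 / c) * ENNReal.ofReal c := by
        rw [← ENNReal.ofReal_mul (by positivity), one_div_mul_cancel hc.ne', ENNReal.ofReal_one]
    _ ≤ _ := by gcongr

/-- Near a critical point the local desingularizing function applies, continued linearly; by
continuity of the Lagrangian on its domain only small values of its argument matter. -/
theorem Scenario.exists_klInequalityOn_of_critical (hP : P.Scenario γ L)
    (hKL : IsKLFunction (P.extLagr γ)) {ws w : P.Space} (hws : P.IsSubgradient γ ws 0)
    (hw : P.IsSubgradient γ w 0) :
    ∃ U ∈ 𝓝 w, ∃ φ, IsDesingularizing ⊤ φ ∧ KLInequalityOn (P.extLagr γ) ws U ⊤ φ := by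
  have hval : P.extLagr γ w = P.extLagr γ ws := by
    rw [extLagr_of_mem γ hw.1, extLagr_of_mem γ hws.1, hw.lagr_eq_lagr hws]
  obtain ⟨η, W, φ, hW, hφ, hineq⟩ := hKL w ⟨0, hP.mem_subdifferential_iff.2 hw⟩
  obtain ⟨a, ha0, haη⟩ := EReal.lt_iff_exists_real_btwn.1 hφ.eta_pos
  have ha : 0 < a := by exact_mod_cast ha0
  obtain ⟨ψ, hψ, hder⟩ := hφ.exists_extension ha haη
  have hnear : {z | P.lagr γ z < P.lagr γ ws + a} ∈ 𝓝 w := by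
    refine hP.continuous_lagr.continuousAt.eventually_lt continuousAt_const ?_
    rw [hw.lagr_eq_lagr hws]
    linarith
  refine ⟨_, inter_mem hW hnear, ψ, hψ, fun z hz hlt htop => ?_⟩
  have hzd : z ∈ P.dom := by
    rw [← extLagr_ne_top_iff γ]
    intro htop'
    rw [htop'] at htop
    exact not_top_lt htop
  have hz2 : P.lagr γ z < P.lagr γ ws + a := hz.2
  rw [extLagr_of_mem γ hzd, extLagr_of_mem γ hws.1] at hlt
  have hlt' : P.lagr γ ws < P.lagr γ z := EReal.coe_lt_coe_iff.1 hlt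
  have h := hineq z hz.1 (by rwa [hval, extLagr_of_mem γ hzd, extLagr_of_mem γ hws.1]) (by
    rw [hval, extLagr_of_mem γ hzd, extLagr_of_mem γ hws.1]
    calc (P.lagr γ z : EReal) < ((P.lagr γ ws + a : ℝ) : EReal) := EReal.coe_lt_coe_iff.2 hz2
      _ = (P.lagr γ ws : EReal) + (a : EReal) := EReal.coe_add _ _
      _ ≤ _ := by gcongr)
  rw [hval] at h
  have harg : (P.extLagr γ z - P.extLagr γ ws).toReal = P.lagr γ z - P.lagr γ ws := by
    rw [extLagr_of_mem γ hzd, extLagr_of_mem γ hws.1, ← EReal.coe_sub, EReal.toReal_coe]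
  rw [harg] at h ⊢
  rwa [hder _ (by linarith) (by linarith)]

/-- All critical values agree, so the local inequalities at the points of a compact set can be
patched by adding finitely many desingularizing functions. -/
theorem Scenario.exists_klInequalityOn_of_isBounded (hP : P.Scenario γ L)
    (hKL : IsKLFunction (P.extLagr γ)) {ws : P.Space} (hws : P.IsSubgradient γ ws 0)
    {B : Set P.Space} (hB : Bornology.IsBounded B) :
    ∃ φ, IsDesingularizing ⊤ φ ∧ KLInequalityOn (P.extLagr γ) ws B ⊤ φ := by
  suffices ∃ φ, IsDesingularizing ⊤ φ ∧ KLInequalityOn (P.extLagr γ) ws (closure B) ⊤ φ by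
    obtain ⟨φ, hφ, h⟩ := this
    exact ⟨φ, hφ, fun z hz => h z (subset_closure hz)⟩
  refine hB.isCompact_closure.induction_on
    (p := fun S => ∃ φ, IsDesingularizing ⊤ φ ∧ KLInequalityOn (P.extLagr γ) ws S ⊤ φ)
    ⟨_, .linear one_pos, fun z hz => hz.elim⟩ ?_ ?_ ?_
  · rintro S T hST ⟨φ, hφ, h⟩
    exact ⟨φ, hφ, fun z hz => h z (hST hz)⟩
  · rintro S T ⟨φ, hφ, h⟩ ⟨ψ, hψ, h'⟩
    refine ⟨_, hφ.add hψ, fun z hz hlt htop => ?_⟩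
    have hzd : z ∈ P.dom := by
      rw [← extLagr_ne_top_iff γ]
      intro htop'
      rw [htop'] at htop
      exact not_top_lt htop
    have hs : 0 < (P.extLagr γ z - P.extLagr γ ws).toReal := by
      rw [extLagr_of_mem γ hzd, extLagr_of_mem γ hws.1] at hlt ⊢
      rw [← EReal.coe_sub, EReal.toReal_coe]
      exact sub_pos.2 (EReal.coe_lt_coe_iff.1 hlt)
    have p1 := hφ.deriv_pos _ hs (EReal.coe_lt_top _)
    have p2 := hψ.deriv_pos _ hs (EReal.coe_lt_top _)
    rw [deriv_fun_add (hφ.differentiableAt hs (EReal.coe_lt_top _))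
      (hψ.differentiableAt hs (EReal.coe_lt_top _))]
    rcases hz with hz | hz
    · refine (h z hz hlt htop).trans ?_
      gcongr
      linarith
    · refine (h' z hz hlt htop).trans ?_
      gcongr
      linarith
  · intro w _
    have : ∃ U ∈ 𝓝 w, ∃ φ, IsDesingularizing ⊤ φ ∧ KLInequalityOn (P.extLagr γ) ws U ⊤ φ := by
      by_cases hw : P.IsSubgradient γ w 0
      · exact hP.exists_klInequalityOn_of_critical hKL hws hw
      · exact hP.exists_linear_klInequalityOn ws hw
    obtain ⟨U, hU, h⟩ := this
    exact ⟨U, mem_nhdsWithin_of_mem_nhds hU, h⟩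

end Critical

variable {γ : ℝ} {L : NNReal}

/-! ### One step of the multi-block ADMM -/

theorem sum_apply_update {ι M : Type*} [Fintype ι] [DecidableEq ι] {E : ι → Type*}
    [AddCommGroup M] (F : ∀ j, E j → M) (u : ∀ j, E j) (i : ι) (z : E i) :
    ∑ j, F j (Function.update u i z j) = F i z + (∑ j, F j (u j) - F i (u i)) := by
  rw [← Finset.add_sum_erase _ _ (Finset.mem_univ i),
    ← Finset.add_sum_erase _ (fun j => F j (u j)) (Finset.mem_univ i), Function.update_self,
    add_sub_cancel_left]
  congr 1
  refine Finset.sum_congr rfl fun j hj => ?_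
  rw [Function.update_of_ne (Finset.ne_of_mem_erase hj)]

theorem residual_update (u : ∀ i : Fin P.m, EuclideanSpace ℝ (Fin (P.n i))) (y : P.V)
    (i : Fin P.m) (z : EuclideanSpace ℝ (Fin (P.n i))) :
    P.residual (Function.update u i z) y = P.A i z + (P.residual u y - P.A i (u i)) := by
  rw [residual, sum_apply_update (fun j => ⇑(P.A j)), residual]
  abel

theorem augLag_update (u : ∀ i : Fin P.m, EuclideanSpace ℝ (Fin (P.n i))) (y l : P.V)
    (i : Fin P.m) (z : EuclideanSpace ℝ (Fin (P.n i))) :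
    P.augLag γ (Function.update u i z) y l =
      (∑ j, P.f j (u j) - P.f i (u i) + P.fN y) +
        (P.f i z - inner ℝ l (P.A i z + (P.residual u y - P.A i (u i)))
          + γ / 2 * ‖P.A i z + (P.residual u y - P.A i (u i))‖ ^ 2) := by
  rw [augLag, residual_update, sum_apply_update P.f]
  ring

theorem augLag_last (u : ∀ i : Fin P.m, EuclideanSpace ℝ (Fin (P.n i))) (z l : P.V) :
    P.augLag γ u z l = ∑ j, P.f j (u j) +
      (P.fN z - inner ℝ l (ContinuousLinearMap.id ℝ P.V z + P.residual u 0)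
          + γ / 2 * ‖ContinuousLinearMap.id ℝ P.V z + P.residual u 0‖ ^ 2) := by
  have : ContinuousLinearMap.id ℝ P.V z + P.residual u 0 = P.residual u z := by
    simp only [residual, ContinuousLinearMap.id_apply]
    abel
  rw [this, augLag]
  ring

theorem isMinOn_of_const_add {E : Type*} {F G : E → ℝ} {s : Set E} {a : E} {c : ℝ}
    (h : IsMinOn F s a) (hFG : ∀ z, F z = c + G z) : IsMinOn G s a := fun z hz => by
  have := h hz
  simp only [Set.mem_ofPred_eq, hFG] at this ⊢
  linarith

/-- The blocks from which `x_i` is updated: the blocks before `i` are taken from `w'`, the others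
from `w`. -/
def sweep (w w' : P.Space) (i : ℕ) : ∀ j : Fin P.m, EuclideanSpace ℝ (Fin (P.n j)) :=
  fun j => if (j : ℕ) < i then x w' j else x w j

theorem sweep_zero (w w' : P.Space) : sweep w w' 0 = x w := by
  funext j; simp [sweep]

theorem sweep_last (w w' : P.Space) : sweep w w' P.m = x w' := by
  funext j; simp [sweep]

theorem sweep_self (w w' : P.Space) (i : Fin P.m) : sweep w w' i i = x w i := by
  simp [sweep]

theorem sweep_succ (w w' : P.Space) (i : Fin P.m) :
    sweep w w' ((i : ℕ) + 1) = Function.update (sweep w w' i) i (x w' i) := by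
  funext j
  by_cases hj : j = i
  · subst hj; simp [sweep]
  · rw [Function.update_of_ne hj]
    have : (j : ℕ) ≠ i := fun h => hj (Fin.ext h)
    simp only [sweep]
    congr 1
    rw [eq_iff_iff]
    omega

theorem norm_residual_sub_sweep_le (w w' : P.Space) (i : ℕ) :
    ‖P.residual (x w') (xN w') - P.residual (sweep w w' i) (xN w)‖ ≤
      ∑ j, ‖P.A j (x w j) - P.A j (x w' j)‖ + ‖xN w - xN w'‖ := by
  have h : P.residual (x w') (xN w') - P.residual (sweep w w' i) (xN w) =
      ∑ j, (P.A j (x w' j) - P.A j (sweep w w' i j)) + (xN w' - xN w) := by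
    rw [residual, residual, Finset.sum_sub_distrib]
    abel
  rw [h]
  refine (norm_add_le _ _).trans (add_le_add ((norm_sum_le _ _).trans ?_) (norm_sub_rev _ _).le)
  refine Finset.sum_le_sum fun j _ => ?_
  by_cases hj : (j : ℕ) < i
  · simp [sweep, hj]
  · simp only [sweep, hj, if_false]
    exact (norm_sub_rev _ _).le

namespace IsADMM

variable {w : ℕ → P.Space}

theorem mem_dom (hw : P.IsADMM γ w) (k : ℕ) : w (k + 1) ∈ P.dom := fun i => hw.x_mem k i

theorem isMinOn_block (hw : P.IsADMM γ w) (k : ℕ) (i : Fin P.m) :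
    IsMinOn (fun z => P.f i z
      - inner ℝ (lam (w k)) (P.A i z +
          (P.residual (sweep (w k) (w (k + 1)) i) (xN (w k)) - P.A i (x (w k) i)))
      + γ / 2 * ‖P.A i z +
          (P.residual (sweep (w k) (w (k + 1)) i) (xN (w k)) - P.A i (x (w k) i))‖ ^ 2)
      (P.X i) (x (w (k + 1)) i) := by
  have h := augLag_update (γ := γ) (sweep (w k) (w (k + 1)) i) (xN (w k)) (lam (w k)) i
  rw [sweep_self] at h
  exact isMinOn_of_const_add (hw.x_min k i) h

theorem block_variational (hP : P.Scenario γ L) (hw : P.IsADMM γ w) (k : ℕ) (i : Fin P.m)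
    {z : EuclideanSpace ℝ (Fin (P.n i))} (hz : z ∈ P.X i) :
    P.f i (x (w (k + 1)) i) + inner ℝ (lam (w k) - γ •
        P.residual (sweep (w k) (w (k + 1)) ((i : ℕ) + 1)) (xN (w k)))
          (P.A i z - P.A i (x (w (k + 1)) i)) ≤ P.f i z := by
  have h := variational_of_isMinOn ((hP.convex_f i).subset (Set.subset_univ _) (hP.convex_X i))
    (P.A i) _ _ γ (hw.x_mem k i) (hw.isMinOn_block k i) hz
  rwa [sweep_succ, residual_update, sweep_self]

theorem block_decrease (hP : P.Scenario γ L) (hw : P.IsADMM γ w) (k : ℕ) (i : Fin P.m)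
    (hx : x (w k) i ∈ P.X i) :
    γ / 2 * ‖P.A i (x (w k) i) - P.A i (x (w (k + 1)) i)‖ ^ 2 ≤
      P.augLag γ (sweep (w k) (w (k + 1)) i) (xN (w k)) (lam (w k)) -
      P.augLag γ (sweep (w k) (w (k + 1)) ((i : ℕ) + 1)) (xN (w k)) (lam (w k)) := by
  have h := quadratic_growth_of_isMinOn
    ((hP.convex_f i).subset (Set.subset_univ _) (hP.convex_X i))
    (P.A i) _ _ γ (hw.x_mem k i) (hw.isMinOn_block k i) hx
  have h0 : sweep (w k) (w (k + 1)) i =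
      Function.update (sweep (w k) (w (k + 1)) i) i (x (w k) i) := by
    conv_lhs => rw [← Function.update_eq_self i (sweep (w k) (w (k + 1)) i), sweep_self]
  rw [sweep_succ, augLag_update, sweep_self, h0, augLag_update, ← h0, sweep_self]
  linarith

theorem isMinOn_last (hw : P.IsADMM γ w) (k : ℕ) :
    IsMinOn (fun z => P.fN z
      - inner ℝ (lam (w k)) (ContinuousLinearMap.id ℝ P.V z + P.residual (x (w (k + 1))) 0)
      + γ / 2 * ‖ContinuousLinearMap.id ℝ P.V z + P.residual (x (w (k + 1))) 0‖ ^ 2)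
      Set.univ (xN (w (k + 1))) :=
  isMinOn_of_const_add (hw.xN_min k) fun _ => augLag_last _ _ _

/-- The updated multiplier is a subgradient of `f_N` at the updated last block. -/
theorem last_variational (hP : P.Scenario γ L) (hw : P.IsADMM γ w) (k : ℕ) (z : P.V) :
    P.fN (xN (w (k + 1))) + inner ℝ (lam (w (k + 1))) (z - xN (w (k + 1))) ≤ P.fN z := by
  have h := variational_of_isMinOn hP.convex_fN _ _ _ γ (Set.mem_univ _) (hw.isMinOn_last k)
    (Set.mem_univ z)
  have e : ContinuousLinearMap.id ℝ P.V (xN (w (k + 1))) + P.residual (x (w (k + 1))) 0 =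
      P.residual (x (w (k + 1))) (xN (w (k + 1))) := by
    simp only [residual, ContinuousLinearMap.id_apply]
    abel
  rwa [e, ← hw.lam_eq k] at h

theorem gradient_eq_lam (hP : P.Scenario γ L) (hw : P.IsADMM γ w) (k : ℕ) :
    gradient P.fN (xN (w (k + 1))) = lam (w (k + 1)) :=
  gradient_eq_of_subgradient (hP.differentiable_fN _) fun z => hw.last_variational hP k z

theorem norm_lam_sub_le (hP : P.Scenario γ L) (hw : P.IsADMM γ w) (k : ℕ) :
    ‖lam (w (k + 1)) - lam (w (k + 2))‖ ≤ L * ‖xN (w (k + 1)) - xN (w (k + 2))‖ := by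
  rw [← hw.gradient_eq_lam hP k, ← hw.gradient_eq_lam hP (k + 1), ← dist_eq_norm, ← dist_eq_norm]
  exact hP.lipschitz_grad.dist_le_mul _ _

theorem last_decrease (hP : P.Scenario γ L) (hw : P.IsADMM γ w) (k : ℕ) :
    γ / 2 * ‖xN (w k) - xN (w (k + 1))‖ ^ 2 ≤
      P.augLag γ (x (w (k + 1))) (xN (w k)) (lam (w k)) -
      P.augLag γ (x (w (k + 1))) (xN (w (k + 1))) (lam (w k)) := by
  have h := quadratic_growth_of_isMinOn hP.convex_fN _ _ _ γ (Set.mem_univ _) (hw.isMinOn_last k)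
    (Set.mem_univ (xN (w k)))
  rw [augLag_last, augLag_last]
  simp only [ContinuousLinearMap.id_apply] at h ⊢
  linarith

theorem residual_eq_smul (hγ : γ ≠ 0) (hw : P.IsADMM γ w) (k : ℕ) :
    P.residual (x (w (k + 1))) (xN (w (k + 1))) = (1 / γ) • (lam (w k) - lam (w (k + 1))) := by
  rw [hw.lam_eq k, sub_sub_cancel, smul_smul, one_div_mul_cancel hγ, one_smul]

theorem multiplier_increase (hP : P.Scenario γ L) (hw : P.IsADMM γ w) (k : ℕ) :
    P.lagr γ (w (k + 1)) = P.augLag γ (x (w (k + 1))) (xN (w (k + 1))) (lam (w k)) +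
      1 / γ * ‖lam (w k) - lam (w (k + 1))‖ ^ 2 := by
  have h : inner ℝ (lam (w k) - lam (w (k + 1))) (P.residual (x (w (k + 1))) (xN (w (k + 1)))) =
      1 / γ * ‖lam (w k) - lam (w (k + 1))‖ ^ 2 := by
    rw [hw.residual_eq_smul hP.gamma_pos.ne' k, real_inner_smul_right, real_inner_self_eq_norm_sq]
  rw [← h, lagr, augLag, augLag, inner_sub_left]
  ring

/-- The primal updates decrease the augmented Lagrangian quadratically; the multiplier update gives
back only `‖λ - λ'‖² / γ`. -/
theorem lagr_decrease (hP : P.Scenario γ L) (hw : P.IsADMM γ w) (k : ℕ) (hk : w k ∈ P.dom) :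
    γ / 2 * ∑ i, ‖P.A i (x (w k) i) - P.A i (x (w (k + 1)) i)‖ ^ 2
      + γ / 2 * ‖xN (w k) - xN (w (k + 1))‖ ^ 2
      - 1 / γ * ‖lam (w k) - lam (w (k + 1))‖ ^ 2 ≤ P.lagr γ (w k) - P.lagr γ (w (k + 1)) := by
  have h1 := Finset.sum_le_sum fun i (_ : i ∈ Finset.univ) => hw.block_decrease hP k i (hk i)
  rw [Fin.sum_univ_eq_sum_range (fun i =>
      P.augLag γ (sweep (w k) (w (k + 1)) i) (xN (w k)) (lam (w k)) -
      P.augLag γ (sweep (w k) (w (k + 1)) (i + 1)) (xN (w k)) (lam (w k))) P.m,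
    Finset.sum_range_sub', sweep_zero, sweep_last, ← Finset.mul_sum] at h1
  have h2 := hw.last_decrease hP k
  rw [hw.multiplier_increase hP k]
  have h3 : P.lagr γ (w k) = P.augLag γ (x (w k)) (xN (w k)) (lam (w k)) := rfl
  linarith

end IsADMM

theorem gap_nonneg (w w' : P.Space) : 0 ≤ P.gap w w' :=
  add_nonneg (add_nonneg (Finset.sum_nonneg fun _ _ => norm_nonneg _) (norm_nonneg _))
    (norm_nonneg _)

theorem gap_sq_le (w w' : P.Space) :
    P.gap w w' ^ 2 ≤ ((P.m : ℝ) + 2) * (∑ i, ‖P.A i (x w i) - P.A i (x w' i)‖ ^ 2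
      + ‖xN w - xN w'‖ ^ 2 + ‖lam w - lam w'‖ ^ 2) := by
  have h := sq_sum_le_card_mul_sum_sq (s := (Finset.univ : Finset (Option (Option (Fin P.m)))))
    (f := fun o => o.elim ‖lam w - lam w'‖ fun o => o.elim ‖xN w - xN w'‖ fun i =>
      ‖P.A i (x w i) - P.A i (x w' i)‖)
  simp only [Fintype.sum_option, Option.elim_none, Option.elim_some, Finset.card_univ,
    Fintype.card_option, Fintype.card_fin] at h
  push_cast at h
  rw [gap]
  linarith

variable (γ L) in
/-- The factor `(γ² - 2 L²) / (2 γ (1 + L²))` of the sufficient decrease of the augmented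
Lagrangian. -/
noncomputable def decreaseRate : ℝ := (γ ^ 2 - 2 * (L : ℝ) ^ 2) / (2 * γ * (1 + (L : ℝ) ^ 2))

theorem Scenario.decreaseRate_pos (hP : P.Scenario γ L) : 0 < decreaseRate γ L :=
  div_pos (sub_pos.2 hP.two_mul_sq_lt) (by have := hP.gamma_pos; positivity)

theorem constM_pos (hγ : 0 < γ) : 0 < P.constM γ :=
  lt_max_of_lt_right (by
    have : 0 ≤ ∑ i, ‖(P.A i).adjoint‖ := Finset.sum_nonneg fun i _ => norm_nonneg _
    positivity)

namespace IsADMM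

variable {w : ℕ → P.Space}

/-- From the second step on the multiplier is a gradient of `f_N`, so its increment is controlled
by that of `x_N`; `γ > √2 L` makes the net change of the Lagrangian a decrease. -/
theorem sufficient_decrease (hP : P.Scenario γ L) (hw : P.IsADMM γ w) (k : ℕ) :
    decreaseRate γ L / ((P.m : ℝ) + 2) * P.gap (w (k + 1)) (w (k + 2)) ^ 2 ≤
      P.lagr γ (w (k + 1)) - P.lagr γ (w (k + 2)) := by
  have hγ := hP.gamma_pos
  have hδ := hP.decreaseRate_pos
  have h1 := hw.lagr_decrease hP (k + 1) (hw.mem_dom k)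
  have h2 := pow_le_pow_left₀ (norm_nonneg _) (hw.norm_lam_sub_le hP k) 2
  have h3 := mul_le_mul_of_nonneg_left (gap_sq_le (w (k + 1)) (w (k + 2))) hδ.le
  have hQ : 0 ≤ ∑ i, ‖P.A i (x (w (k + 1)) i) - P.A i (x (w (k + 2)) i)‖ ^ 2 :=
    Finset.sum_nonneg fun _ _ => sq_nonneg _
  have hb := sq_nonneg ‖xN (w (k + 1)) - xN (w (k + 2))‖
  rw [mul_pow] at h2
  rw [show k + 1 + 1 = k + 2 from rfl] at h1
  rw [div_mul_eq_mul_div, div_le_iff₀ (by positivity)]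
  set Q := ∑ i, ‖P.A i (x (w (k + 1)) i) - P.A i (x (w (k + 2)) i)‖ ^ 2
  set b := ‖xN (w (k + 1)) - xN (w (k + 2))‖ ^ 2
  set c := ‖lam (w (k + 1)) - lam (w (k + 2))‖ ^ 2
  set δ := decreaseRate γ L with hδdef
  have e1 : γ / 2 - (L : ℝ) ^ 2 / γ = δ * (1 + (L : ℝ) ^ 2) := by
    rw [hδdef, decreaseRate]
    field_simp
  have e2 : δ ≤ γ / 2 := by
    have : 0 ≤ (L : ℝ) ^ 2 / γ := by positivity
    have : 0 ≤ δ * (L : ℝ) ^ 2 := by positivity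
    linarith
  have key : δ * (Q + b + c) ≤ P.lagr γ (w (k + 1)) - P.lagr γ (w (k + 2)) := by
    have q1 := mul_le_mul_of_nonneg_right e2 hQ
    have q2 : (δ + 1 / γ) * c ≤ (δ + 1 / γ) * ((L : ℝ) ^ 2 * b) :=
      mul_le_mul_of_nonneg_left h2 (by positivity)
    have q3 : (γ / 2 - (L : ℝ) ^ 2 / γ) * b = δ * (1 + (L : ℝ) ^ 2) * b := by rw [e1]
    have q4 : (L : ℝ) ^ 2 / γ * b = 1 / γ * ((L : ℝ) ^ 2 * b) := by ring
    linarith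
  have hm : (0 : ℝ) ≤ (P.m : ℝ) + 2 := by positivity
  have := mul_le_mul_of_nonneg_right key hm
  linarith

/-- The optimality conditions of the block updates, corrected for the blocks and the multiplier
updated later, give a subgradient at the new iterate which is controlled by the step. -/
theorem exists_isSubgradient (hP : P.Scenario γ L) (hw : P.IsADMM γ w) (k : ℕ) :
    ∃ d, P.IsSubgradient γ (w (k + 1)) d ∧ ‖d‖ ≤ P.constM γ * P.gap (w k) (w (k + 1)) := by
  have hγ := hP.gamma_pos
  set r := P.residual (x (w (k + 1))) (xN (w (k + 1))) with hr
  set R : Fin P.m → P.V := fun i =>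
    P.residual (sweep (w k) (w (k + 1)) ((i : ℕ) + 1)) (xN (w k)) with hR
  set S := ∑ j, ‖P.A j (x (w k) j) - P.A j (x (w (k + 1)) j)‖ + ‖xN (w k) - xN (w (k + 1))‖ with hS
  set T := ‖lam (w k) - lam (w (k + 1))‖ with hT
  set v : Fin P.m → P.V := fun i => (lam (w k) - lam (w (k + 1))) + γ • (r - R i) with hv
  set d : P.Space := WithLp.toLp 2 (WithLp.toLp 2 fun i => (P.A i).adjoint (v i),
    WithLp.toLp 2 (γ • r, -r)) with hd
  have hdx : ∀ i, x d i = (P.A i).adjoint (v i) := fun i => rfl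
  have hdN : xN d = γ • r := rfl
  have hdl : lam d = -r := rfl
  refine ⟨d, ⟨hw.mem_dom k, fun w' hw' => ?_⟩, ?_⟩
  · have hcr : P.constraintL (w (k + 1)) - P.b = r := (residual_eq _).symm
    have h1 := Finset.sum_le_sum fun i (_ : i ∈ Finset.univ) =>
      hw.block_variational hP k i (hw' i)
    have h2 := hw.last_variational hP k (xN w')
    have hx : ∀ i, P.A i (x (w' - w (k + 1)) i) = P.A i (x w' i) - P.A i (x (w (k + 1)) i) :=
      fun i => by rw [← map_sub]; rfl
    have h3 : ∀ i, inner ℝ (x d i) (x (w' - w (k + 1)) i) =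
        inner ℝ (lam (w k) - γ • R i) (P.A i (x w' i) - P.A i (x (w (k + 1)) i)) +
        inner ℝ (γ • r - lam (w (k + 1))) (P.A i (x w' i) - P.A i (x (w (k + 1)) i)) := by
      intro i
      rw [hdx, ContinuousLinearMap.adjoint_inner_left, hx, ← inner_add_left]
      congr 1
      simp only [hv]
      module
    have h4 : xN (w' - w (k + 1)) = xN w' - xN (w (k + 1)) := rfl
    rw [inner_space, couplingDeriv, hcr, constraintL_apply, Finset.sum_congr rfl fun i _ => h3 i,
      Finset.sum_congr rfl fun i _ => hx i, inner_add_right, inner_sum, hdN, hdl, h4,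
      inner_neg_left, Finset.sum_add_distrib, real_inner_comm (lam (w' - w (k + 1))) r,
      inner_sub_left (γ • r) (lam (w (k + 1))) (xN w' - xN (w (k + 1)))]
    rw [Finset.sum_add_distrib] at h1
    simp only [objective]
    linarith
  · have hS0 : 0 ≤ S := add_nonneg (Finset.sum_nonneg fun _ _ => norm_nonneg _) (norm_nonneg _)
    have hT0 : 0 ≤ T := norm_nonneg _
    have hrn : ‖r‖ = 1 / γ * T := by
      rw [hr, hw.residual_eq_smul hγ.ne' k, norm_smul, Real.norm_eq_abs, abs_of_pos (by positivity)]
    have hvn : ∀ i, ‖v i‖ ≤ T + γ * S := fun i => by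
      refine (norm_add_le _ _).trans (add_le_add le_rfl ?_)
      rw [norm_smul, Real.norm_eq_abs, abs_of_pos hγ]
      exact mul_le_mul_of_nonneg_left (norm_residual_sub_sweep_le _ _ _) hγ.le
    have hdxn : ∑ i, ‖x d i‖ ≤ (∑ i, ‖(P.A i).adjoint‖) * (T + γ * S) := by
      rw [Finset.sum_mul]
      refine Finset.sum_le_sum fun i _ => ?_
      rw [hdx]
      exact ((P.A i).adjoint.le_opNorm _).trans
        (mul_le_mul_of_nonneg_left (hvn i) (norm_nonneg _))
    have hdNn : ‖xN d‖ = T := by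
      rw [hdN, norm_smul, Real.norm_eq_abs, abs_of_pos hγ, hrn, ← mul_assoc,
        mul_one_div_cancel hγ.ne', one_mul]
    have hdln : ‖lam d‖ = 1 / γ * T := by rw [hdl, norm_neg, hrn]
    have hgap : P.gap (w k) (w (k + 1)) = S + T := rfl
    have m1 := mul_le_mul_of_nonneg_right (le_max_left (γ * ∑ i, ‖(P.A i).adjoint‖)
      (1 / γ + 1 + ∑ i, ‖(P.A i).adjoint‖)) hS0
    have m2 := mul_le_mul_of_nonneg_right (le_max_right (γ * ∑ i, ‖(P.A i).adjoint‖)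
      (1 / γ + 1 + ∑ i, ‖(P.A i).adjoint‖)) hT0
    have := norm_space_le d
    rw [hgap, constM]
    linarith

/-! ### Boundedness and limit points of the iterates -/

theorem antitone_lagr (hP : P.Scenario γ L) (hw : P.IsADMM γ w) :
    Antitone fun k => P.lagr γ (w (k + 1)) := by
  refine antitone_nat_of_succ_le fun k => ?_
  have h := hw.sufficient_decrease hP k
  have := hP.decreaseRate_pos
  have : 0 ≤ decreaseRate γ L / ((P.m : ℝ) + 2) * P.gap (w (k + 1)) (w (k + 2)) ^ 2 := by positivity
  change P.lagr γ (w (k + 2)) ≤ P.lagr γ (w (k + 1))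
  linarith

/-- As `λ = ∇f_N(x_N)` along the iterates, the descent lemma absorbs the multiplier term into
`f_N` and half of the penalty. -/
theorem le_lagr (hP : P.Scenario γ L) (hw : P.IsADMM γ w) (k : ℕ) {c : ℝ}
    (hc : ∀ z, c ≤ P.fN z) :
    ∑ i, P.f i (x (w (k + 1)) i) + c +
      (γ - L) / 2 * ‖P.residual (x (w (k + 1))) (xN (w (k + 1)))‖ ^ 2 ≤ P.lagr γ (w (k + 1)) := by
  rw [lagr, augLag]
  set r := P.residual (x (w (k + 1))) (xN (w (k + 1)))
  have h := le_quadratic_of_lipschitzWith_gradient hP.differentiable_fN hP.lipschitz_grad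
    (xN (w (k + 1))) (-r)
  rw [hw.gradient_eq_lam hP k, inner_neg_right, norm_neg] at h
  have := hc (xN (w (k + 1)) + -r)
  linarith

theorem exists_norm_block_le (hP : P.Scenario γ L) (i : Fin P.m) (K : ℝ) :
    ∃ C, ∀ z ∈ P.X i, P.f i z ≤ K → ‖z‖ ≤ C := by
  have h := (hP.coercive i).eventually (eventually_gt_atTop K)
  rw [eventually_inf_principal] at h
  have hb : Bornology.IsBounded {z | z ∈ P.X i → K < P.f i z}ᶜ :=
    Bornology.isBounded_def.2 (by rwa [compl_compl])
  obtain ⟨C, hC⟩ := hb.exists_norm_le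
  exact ⟨C, fun z hz hzK => hC z fun hcon => absurd (hcon hz) (not_lt.2 hzK)⟩

theorem isBounded_range (hP : P.Scenario γ L) (hw : P.IsADMM γ w) :
    Bornology.IsBounded (Set.range w) := by
  have hγ := hP.gamma_pos
  have hγL : (L : ℝ) < γ := by
    have h1 : (1 : ℝ) ≤ √2 := Real.one_le_sqrt.2 one_le_two
    have := mul_le_mul_of_nonneg_right h1 L.coe_nonneg
    linarith [hP.gamma_gt]
  obtain ⟨c, hc⟩ := hP.bddBelow_fN
  have hc : ∀ z, c ≤ P.fN z := fun z => hc ⟨z, rfl⟩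
  choose a ha using hP.bddBelow_f
  have ha : ∀ k i, a i ≤ P.f i (x (w (k + 1)) i) := fun k i => ha i ⟨_, hw.mem_dom k i, rfl⟩
  set K := P.lagr γ (w 1) - c - ∑ i, a i with hK
  have hlow : ∀ k, ∑ i, (P.f i (x (w (k + 1)) i) - a i) +
      (γ - L) / 2 * ‖P.residual (x (w (k + 1))) (xN (w (k + 1)))‖ ^ 2 ≤ K := fun k => by
    have h1 := hw.le_lagr hP k hc
    have h2 : P.lagr γ (w (k + 1)) ≤ P.lagr γ (w 1) := hw.antitone_lagr hP (Nat.zero_le k)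
    rw [Finset.sum_sub_distrib]
    linarith
  have hpen : ∀ k, 0 ≤ (γ - L) / 2 * ‖P.residual (x (w (k + 1))) (xN (w (k + 1)))‖ ^ 2 :=
    fun k => mul_nonneg (by linarith) (sq_nonneg _)
  choose C hC using fun i => exists_norm_block_le hP i (K + a i)
  have hx : ∀ k i, ‖x (w (k + 1)) i‖ ≤ C i := fun k i => by
    refine hC i _ (hw.mem_dom k i) ?_
    have := Finset.single_le_sum (f := fun i => P.f i (x (w (k + 1)) i) - a i)
      (fun j _ => sub_nonneg.2 (ha k j)) (Finset.mem_univ i)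
    linarith [hlow k, hpen k]
  set ρ := √(K / ((γ - L) / 2)) with hρ
  have hr : ∀ k, ‖P.residual (x (w (k + 1))) (xN (w (k + 1)))‖ ≤ ρ := fun k => by
    refine Real.le_sqrt_of_sq_le ?_
    rw [le_div_iff₀ (by linarith)]
    have := Finset.sum_nonneg fun i (_ : i ∈ Finset.univ) => sub_nonneg.2 (ha k i)
    linarith [hlow k]
  set Y := ρ + ∑ i, ‖P.A i‖ * C i + ‖P.b‖ with hY
  have hy : ∀ k, ‖xN (w (k + 1))‖ ≤ Y := fun k => by
    have e : xN (w (k + 1)) = P.residual (x (w (k + 1))) (xN (w (k + 1)))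
        - ∑ i, P.A i (x (w (k + 1)) i) + P.b := by rw [residual]; abel
    have h1 : ‖∑ i, P.A i (x (w (k + 1)) i)‖ ≤ ∑ i, ‖P.A i‖ * C i :=
      (norm_sum_le _ _).trans (Finset.sum_le_sum fun i _ => ((P.A i).le_opNorm _).trans
        (mul_le_mul_of_nonneg_left (hx k i) (norm_nonneg _)))
    have h2 : ‖xN (w (k + 1))‖ ≤ ‖P.residual (x (w (k + 1))) (xN (w (k + 1)))‖
        + ‖∑ i, P.A i (x (w (k + 1)) i)‖ + ‖P.b‖ := by
      conv_lhs => rw [e]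
      exact (norm_add_le _ _).trans (add_le_add (norm_sub_le _ _) le_rfl)
    linarith [hr k]
  have hl : ∀ k, ‖lam (w (k + 1))‖ ≤ ‖gradient P.fN 0‖ + L * Y := fun k => by
    have h1 := hP.lipschitz_grad.dist_le_mul (xN (w (k + 1))) 0
    rw [hw.gradient_eq_lam hP k, dist_eq_norm, dist_zero_right] at h1
    have h2 := mul_le_mul_of_nonneg_left (hy k) L.coe_nonneg
    have h3 := norm_le_norm_add_norm_sub' (lam (w (k + 1))) (gradient P.fN 0)
    linarith
  refine isBounded_iff_forall_norm_le.2
    ⟨max ‖w 0‖ (∑ i, C i + Y + (‖gradient P.fN 0‖ + L * Y)), ?_⟩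
  rintro _ ⟨k, rfl⟩
  rcases k with _ | k
  · exact le_max_left _ _
  · refine le_max_of_le_right ((norm_space_le _).trans ?_)
    exact add_le_add (add_le_add (Finset.sum_le_sum fun i _ => hx k i) (hy k)) (hl k)

theorem limitPoints_nonempty (hP : P.Scenario γ L) (hw : P.IsADMM γ w) :
    (limitPoints w).Nonempty := by
  obtain ⟨a, -, κ, hκ, h⟩ := tendsto_subseq_of_bounded (hw.isBounded_range hP)
    fun k => Set.mem_range_self k
  exact ⟨a, κ, hκ, h⟩

theorem tendsto_lagr (hP : P.Scenario γ L) (hw : P.IsADMM γ w) {ws : P.Space}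
    (hws : ws ∈ limitPoints w) :
    Tendsto (fun k => P.lagr γ (w (k + 1))) atTop (𝓝 (P.lagr γ ws)) := by
  obtain ⟨κ, hκ, h⟩ := hws
  have h1 : Tendsto (fun l => P.lagr γ (w (κ l))) atTop (𝓝 (P.lagr γ ws)) :=
    (hP.continuous_lagr.tendsto ws).comp h
  -- The Lagrangian is antitone only from the first iterate on, hence the shift of the subsequence.
  have hg : Tendsto (fun l => κ (l + 1) - 1) atTop atTop :=
    (tendsto_sub_atTop_nat 1).comp ((tendsto_add_atTop_iff_nat 1).2 hκ.tendsto_atTop)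
  rw [tendsto_iff_tendsto_subseq_of_antitone (hw.antitone_lagr hP) hg]
  refine ((tendsto_add_atTop_iff_nat 1).2 h1).congr fun l => ?_
  have hpos : 1 ≤ κ (l + 1) := (Nat.zero_le _).trans_lt (hκ (Nat.lt_succ_self l))
  simp only [Function.comp_apply, Nat.sub_add_cancel hpos]

theorem lagr_limit_le (hP : P.Scenario γ L) (hw : P.IsADMM γ w) {ws : P.Space}
    (hws : ws ∈ limitPoints w) (k : ℕ) : P.lagr γ ws ≤ P.lagr γ (w (k + 1)) :=
  (hw.antitone_lagr hP).le_of_tendsto (hw.tendsto_lagr hP hws) k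

theorem tendsto_gap_zero (hP : P.Scenario γ L) (hw : P.IsADMM γ w) :
    Tendsto (fun k => P.gap (w k) (w (k + 1))) atTop (𝓝 0) := by
  obtain ⟨ws, hws⟩ := hw.limitPoints_nonempty hP
  have hδ : 0 < decreaseRate γ L / ((P.m : ℝ) + 2) := div_pos hP.decreaseRate_pos (by positivity)
  have h1 := hw.tendsto_lagr hP hws
  have h2 : Tendsto (fun k => (P.lagr γ (w (k + 1)) - P.lagr γ (w (k + 2))) /
      (decreaseRate γ L / ((P.m : ℝ) + 2))) atTop (𝓝 0) := by
    simpa using (h1.sub ((tendsto_add_atTop_iff_nat 1).2 h1)).div_const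
      (decreaseRate γ L / ((P.m : ℝ) + 2))
  have h3 : Tendsto (fun k => P.gap (w (k + 1)) (w (k + 2)) ^ 2) atTop (𝓝 0) :=
    squeeze_zero (fun _ => sq_nonneg _)
      (fun k => by rw [le_div_iff₀' hδ]; exact hw.sufficient_decrease hP k) h2
  have h4 := h3.sqrt
  simp only [Real.sqrt_sq (gap_nonneg _ _), Real.sqrt_zero] at h4
  exact (tendsto_add_atTop_iff_nat 1).1 h4

/-- The steps, hence the subgradients at the iterates, tend to zero, and the graph of the
subdifferential is closed: every limit point is critical. -/
theorem isSubgradient_limit (hP : P.Scenario γ L) (hw : P.IsADMM γ w) {ws : P.Space}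
    (hws : ws ∈ limitPoints w) : P.IsSubgradient γ ws 0 := by
  obtain ⟨κ, hκ, h⟩ := hws
  choose d hd hdn using hw.exists_isSubgradient hP
  have hd0 : Tendsto d atTop (𝓝 0) := by
    refine squeeze_zero_norm hdn ?_
    simpa using (hw.tendsto_gap_zero hP).const_mul (P.constM γ)
  have hg : Tendsto (fun l => κ (l + 1) - 1) atTop atTop :=
    (tendsto_sub_atTop_nat 1).comp ((tendsto_add_atTop_iff_nat 1).2 hκ.tendsto_atTop)
  refine hP.isClosed_isSubgradient.mem_of_tendsto
    (((tendsto_add_atTop_iff_nat 1).2 h).prodMk_nhds (hd0.comp hg))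
    (Eventually.of_forall fun l => ?_)
  have hpos : 1 ≤ κ (l + 1) := (Nat.zero_le _).trans_lt (hκ (Nat.lt_succ_self l))
  have := hd (κ (l + 1) - 1)
  rwa [Nat.sub_add_cancel hpos] at this

end IsADMM

/-! ### Finite length -/

theorem Scenario.constG_eq (hP : P.Scenario γ L) (w : ℕ → P.Space) (ws : P.Space) (φ : ℝ → ℝ) :
    P.constG γ L w ws φ = 2 * P.gap (w 0) (w 1) +
      P.constM γ / decreaseRate γ L * φ (P.lagr γ (w 1) - P.lagr γ ws) := by
  have h1 := hP.gamma_pos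
  have h2 : γ ^ 2 - 2 * (L : ℝ) ^ 2 ≠ 0 := (sub_pos.2 hP.two_mul_sq_lt).ne'
  rw [constG, decreaseRate, div_div_eq_mul_div]
  ring

theorem IsUniformKL.const_mul {w : ℕ → P.Space} {ws : P.Space} {W : Set P.Space} {η : EReal}
    {φ : ℝ → ℝ} (h : P.IsUniformKL γ w ws W η φ) {a : ℝ} (ha : 1 ≤ a) :
    P.IsUniformKL γ w ws W η (fun s => a * φ s) where
  desing := h.desing.const_mul (one_pos.trans_le ha)
  isOpen := h.isOpen
  limitPoints_subset := h.limitPoints_subset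
  ineq z hz hlt hη := by
    refine (h.ineq z hz hlt hη).trans ?_
    rw [deriv_const_mul_field, ENNReal.ofReal_mul (zero_le_one.trans ha)]
    gcongr
    exact le_mul_of_one_le_left zero_le (ENNReal.one_le_ofReal.2 ha)
  iterate_mem := h.iterate_mem
  iterate_lt := h.iterate_lt

namespace IsADMM

variable {w : ℕ → P.Space} {ws : P.Space} {W : Set P.Space} {η : EReal} {φ : ℝ → ℝ}

theorem exists_isUniformKL (hP : P.Scenario γ L) (hKL : IsKLFunction (P.extLagr γ))
    (hw : P.IsADMM γ w) (hws : ws ∈ limitPoints w) :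
    ∃ (ε : ℝ) (φ : ℝ → ℝ), 0 < ε ∧
      P.IsUniformKL γ w ws (Metric.thickening ε (limitPoints w)) ⊤ φ := by
  have hbdd := hw.isBounded_range hP
  have hΩ : Bornology.IsBounded (limitPoints w) := by
    refine (Metric.isBounded_closure_of_isBounded hbdd).subset ?_
    rintro a ⟨κ, -, h⟩
    exact mem_closure_of_tendsto h (Eventually.of_forall fun l => Set.mem_range_self _)
  -- The neighbourhood has to contain all iterates, so its radius is taken large.
  obtain ⟨ρ, hρ⟩ := (Metric.isBounded_iff_subset_ball ws).1 hbdd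
  have hmem : ∀ k, dist (w k) ws < ρ := fun k => hρ (Set.mem_range_self k)
  have hρ0 : 0 < ρ := dist_nonneg.trans_lt (hmem 0)
  obtain ⟨φ, hφ, hineq⟩ := hP.exists_klInequalityOn_of_isBounded hKL
    (hw.isSubgradient_limit hP hws) (hΩ.thickening (δ := ρ))
  refine ⟨ρ, φ, hρ0, hφ, Metric.isOpen_thickening, Metric.self_subset_thickening hρ0 _, hineq,
    fun k _ => Metric.mem_thickening_iff.2 ⟨ws, hws, hmem k⟩, fun k hk => ?_⟩
  obtain ⟨j, rfl⟩ := Nat.exists_eq_add_of_le' hk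
  rw [extLagr_of_mem γ (hw.mem_dom j), EReal.add_top_of_ne_bot (extLagr_ne_bot γ ws)]
  exact EReal.coe_lt_top _

theorem lagr_sub_lt (hP : P.Scenario γ L) (hw : P.IsADMM γ w) (hws : ws ∈ limitPoints w)
    (h : P.IsUniformKL γ w ws W η φ) (k : ℕ) :
    ((P.lagr γ (w (k + 1)) - P.lagr γ ws : ℝ) : EReal) < η := by
  have h1 := h.iterate_lt (k + 1) (Nat.le_add_left 1 k)
  rw [extLagr_of_mem γ (hw.mem_dom k), extLagr_of_mem γ (hw.isSubgradient_limit hP hws).1] at h1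
  rw [EReal.coe_sub]
  refine EReal.sub_lt_of_lt_add ?_
  rwa [add_comm η]

/-- One step of the finite-length estimate: the inequality compares the decrease of
`φ (ℒ - ℒ*)`, via concavity and the subgradient bound, with `Δ_{k+1}² / Δ_k`, and the inequality
between arithmetic and geometric mean makes this linear. -/
theorem two_mul_gap_le (hP : P.Scenario γ L) (hw : P.IsADMM γ w) (hws : ws ∈ limitPoints w)
    (h : P.IsUniformKL γ w ws W η φ) (k : ℕ) :
    2 * P.gap (w (k + 1)) (w (k + 2)) ≤ P.gap (w k) (w (k + 1)) +
      P.constM γ / decreaseRate γ L * (((P.m : ℝ) + 2) *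
        (φ (P.lagr γ (w (k + 1)) - P.lagr γ ws) - φ (P.lagr γ (w (k + 2)) - P.lagr γ ws))) := by
  have hδ := hP.decreaseRate_pos
  have hM : 0 < P.constM γ := constM_pos hP.gamma_pos
  have hdec := hw.sufficient_decrease hP k
  have hg0 := gap_nonneg (w k) (w (k + 1))
  have hg1 := gap_nonneg (w (k + 1)) (w (k + 2))
  have hm : (0 : ℝ) < (P.m : ℝ) + 2 := by positivity
  have h2 := hw.lagr_limit_le hP hws (k + 1)
  rw [show k + 1 + 1 = k + 2 from rfl] at h2
  rcases (hw.lagr_limit_le hP hws k).eq_or_lt with heq | hlt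
  · -- The limit value is already attained, so the iteration is stationary.
    have hz : P.lagr γ (w (k + 2)) = P.lagr γ (w (k + 1)) := by
      refine le_antisymm (hw.antitone_lagr hP (Nat.le_succ k)) ?_
      rw [← heq]; exact h2
    have hgap : P.gap (w (k + 1)) (w (k + 2)) = 0 := by
      rw [hz, sub_self] at hdec
      have hc : 0 < decreaseRate γ L / ((P.m : ℝ) + 2) := by positivity
      exact (pow_eq_zero_iff two_ne_zero).1
        (le_antisymm (nonpos_of_mul_nonpos_right hdec hc) (sq_nonneg _))
    rw [hgap, hz, sub_self]
    simpa using hg0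
  set s := P.lagr γ (w (k + 1)) - P.lagr γ ws with hs
  set t := P.lagr γ (w (k + 2)) - P.lagr γ ws with ht
  have hs0 : 0 < s := sub_pos.2 hlt
  have ht0 : 0 ≤ t := sub_nonneg.2 h2
  have hst : s - t = P.lagr γ (w (k + 1)) - P.lagr γ (w (k + 2)) := by rw [hs, ht]; ring
  have hts : t ≤ s := sub_le_sub_right (hw.antitone_lagr hP (Nat.le_succ k)) _
  have hsη := hw.lagr_sub_lt hP hws h k
  have hconc := h.desing.le_sub_of_concave hs0 hsη ht0 hts
  have hφ' := h.desing.deriv_pos s hs0 hsη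
  obtain ⟨d, hd, hdn⟩ := hw.exists_isSubgradient hP k
  have hkl : 1 ≤ deriv φ s * (P.constM γ * P.gap (w k) (w (k + 1))) := by
    have e1 := extLagr_of_mem γ (hw.mem_dom k)
    have e2 := extLagr_of_mem γ (hw.isSubgradient_limit hP hws).1
    have h1 := h.ineq (w (k + 1)) (h.iterate_mem _ (Nat.le_add_left 1 k))
      (by rw [e1, e2]; exact EReal.coe_lt_coe_iff.2 hlt) (h.iterate_lt _ (Nat.le_add_left 1 k))
    rw [e1, e2, ← EReal.coe_sub, EReal.toReal_coe, ← hs] at h1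
    have h3 : Metric.infEDist 0 (subdifferential (P.extLagr γ) (w (k + 1))) ≤
        ENNReal.ofReal (P.constM γ * P.gap (w k) (w (k + 1))) := by
      refine (Metric.infEDist_le_edist_of_mem (hP.mem_subdifferential_iff.2 hd)).trans ?_
      rw [edist_dist, dist_zero_left]
      exact ENNReal.ofReal_le_ofReal hdn
    have h4 := h1.trans (mul_le_mul_right h3 _)
    rwa [← ENNReal.ofReal_mul hφ'.le, ENNReal.one_le_ofReal] at h4
  set D := P.constM γ / decreaseRate γ L * (((P.m : ℝ) + 2) * (φ s - φ t)) with hD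
  set a := P.gap (w k) (w (k + 1)) with ha
  set g := P.gap (w (k + 1)) (w (k + 2)) with hg
  have hst0 : 0 ≤ s - t := sub_nonneg.2 hts
  have hφst : 0 ≤ φ s - φ t := (mul_nonneg hφ'.le hst0).trans hconc
  have hD0 : 0 ≤ D := by positivity
  have hsq : g ^ 2 ≤ a * D := by
    have q1 : s - t ≤ (s - t) * (deriv φ s * (P.constM γ * a)) := le_mul_of_one_le_right hst0 hkl
    have q2 : deriv φ s * (s - t) * (P.constM γ * a) ≤ (φ s - φ t) * (P.constM γ * a) :=
      mul_le_mul_of_nonneg_right hconc (by positivity)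
    have q3 : decreaseRate γ L / ((P.m : ℝ) + 2) * g ^ 2 ≤ (φ s - φ t) * (P.constM γ * a) := by
      linarith
    rw [div_mul_eq_mul_div, div_le_iff₀ hm, ← le_div_iff₀' hδ] at q3
    refine q3.trans (le_of_eq ?_)
    rw [hD]
    field_simp
  nlinarith [sq_nonneg (a - D)]

theorem sum_gap_le (hP : P.Scenario γ L) (hw : P.IsADMM γ w) (hws : ws ∈ limitPoints w)
    (h : P.IsUniformKL γ w ws W η φ) (n : ℕ) :
    ∑ k ∈ Finset.range n, P.gap (w k) (w (k + 1)) ≤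
      P.constG γ L w ws (fun s => ((P.m : ℝ) + 2) * φ s) := by
  have hC : 0 ≤ P.constM γ / decreaseRate γ L * ((P.m : ℝ) + 2) := by
    have h1 := hP.decreaseRate_pos
    have h2 : 0 < P.constM γ := constM_pos hP.gamma_pos
    positivity
  have key : ∀ n, ∑ k ∈ Finset.range (n + 1), P.gap (w k) (w (k + 1)) + P.gap (w n) (w (n + 1)) +
      P.constM γ / decreaseRate γ L * ((P.m : ℝ) + 2) * φ (P.lagr γ (w (n + 1)) - P.lagr γ ws) ≤
      P.constG γ L w ws (fun s => ((P.m : ℝ) + 2) * φ s) := by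
    intro n
    rw [hP.constG_eq]
    induction n with
    | zero => simp only [Finset.sum_range_one, zero_add]; linarith
    | succ n ih =>
      have := hw.two_mul_gap_le hP hws h n
      rw [Finset.sum_range_succ]
      linarith
  have hφ := h.desing.nonneg _ (sub_nonneg.2 (hw.lagr_limit_le hP hws n)) (hw.lagr_sub_lt hP hws h n)
  have h1 := mul_nonneg hC hφ
  have h2 := gap_nonneg (w n) (w (n + 1))
  have h3 := key n
  rw [Finset.sum_range_succ] at h3
  linarith

theorem summable_gap (hP : P.Scenario γ L) (hw : P.IsADMM γ w) (hws : ws ∈ limitPoints w)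
    (h : P.IsUniformKL γ w ws W η φ) : Summable fun k => P.gap (w k) (w (k + 1)) :=
  summable_of_sum_range_le (fun _ => gap_nonneg _ _) (hw.sum_gap_le hP hws h)

theorem tsum_gap_le (hP : P.Scenario γ L) (hw : P.IsADMM γ w) (hws : ws ∈ limitPoints w)
    (h : P.IsUniformKL γ w ws W η φ) :
    ∑' k, P.gap (w k) (w (k + 1)) ≤ P.constG γ L w ws (fun s => ((P.m : ℝ) + 2) * φ s) :=
  Real.tsum_le_of_sum_range_le (fun _ => gap_nonneg _ _) (hw.sum_gap_le hP hws h)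

end IsADMM

/-- A continuous image of the iterates whose increments are dominated by a summable sequence
converges to the image of any limit point. -/
theorem tendsto_of_summable_dist {V : Type*} [PseudoMetricSpace V] {w : ℕ → P.Space}
    {ws : P.Space} (hws : ws ∈ limitPoints w) {g : P.Space → V} (hg : Continuous g) {a : ℕ → ℝ}
    (ha : Summable a) (h : ∀ k, dist (g (w k)) (g (w (k + 1))) ≤ a k) :
    Tendsto (fun k => g (w k)) atTop (𝓝 (g ws)) := by
  obtain ⟨κ, hκ, hlim⟩ := hws
  refine tendsto_nhds_of_cauchySeq_of_subseq (cauchySeq_of_dist_le_of_summable a h ha)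
    hκ.tendsto_atTop ((hg.tendsto ws).comp hlim)

theorem norm_map_block_sub_le_gap (w w' : P.Space) (i : Fin P.m) :
    ‖P.A i (x w i) - P.A i (x w' i)‖ ≤ P.gap w w' := by
  have h := Finset.single_le_sum (f := fun i => ‖P.A i (x w i) - P.A i (x w' i)‖)
    (fun _ _ => norm_nonneg _) (Finset.mem_univ i)
  rw [gap]
  linarith [norm_nonneg (xN w - xN w'), norm_nonneg (lam w - lam w')]

theorem norm_xN_sub_le_gap (w w' : P.Space) : ‖xN w - xN w'‖ ≤ P.gap w w' := by
  have h : 0 ≤ ∑ i, ‖P.A i (x w i) - P.A i (x w' i)‖ := Finset.sum_nonneg fun _ _ => norm_nonneg _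
  rw [gap]
  linarith [norm_nonneg (lam w - lam w')]

theorem norm_lam_sub_le_gap (w w' : P.Space) : ‖lam w - lam w'‖ ≤ P.gap w w' := by
  have h : 0 ≤ ∑ i, ‖P.A i (x w i) - P.A i (x w' i)‖ := Finset.sum_nonneg fun _ _ => norm_nonneg _
  rw [gap]
  linarith [norm_nonneg (xN w - xN w')]

end Problem

end ADMMKL

theorem mainTheorem3 (P : ADMMKL.Problem) (γ : ℝ) (L : NNReal)
    (hP : P.Scenario γ L)
    (hKL : ADMMKL.IsKLFunction (P.extLagr γ))
    (w : ℕ → P.Space) (hw : P.IsADMM γ w) :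
    (ADMMKL.limitPoints w).Nonempty ∧
    ∀ ws ∈ ADMMKL.limitPoints w,
      Summable (fun k => P.gap (w k) (w (k + 1))) ∧
      (∃ (ε : ℝ) (η : EReal) (φ : ℝ → ℝ), 0 < ε ∧
        P.IsUniformKL γ w ws (Metric.thickening ε (ADMMKL.limitPoints w)) η φ ∧
        ∑' k, P.gap (w k) (w (k + 1)) ≤ P.constG γ L w ws φ) ∧
      (∀ (W : Set P.Space) (η : EReal) (φ : ℝ → ℝ), P.IsUniformKL γ w ws W η φ →
        ∑' k, P.gap (w k) (w (k + 1)) ≤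
          P.constG γ L w ws (fun s => ((P.m : ℝ) + 2) * φ s)) ∧
      (∀ i, Filter.Tendsto (fun k => P.A i (ADMMKL.Problem.x (w k) i)) Filter.atTop
        (nhds (P.A i (ADMMKL.Problem.x ws i)))) ∧
      Filter.Tendsto (fun k => ADMMKL.Problem.xN (w k)) Filter.atTop
        (nhds (ADMMKL.Problem.xN ws)) ∧
      Filter.Tendsto (fun k => ADMMKL.Problem.lam (w k)) Filter.atTop
        (nhds (ADMMKL.Problem.lam ws)) := by
  refine ⟨hw.limitPoints_nonempty hP, fun ws hws => ?_⟩
  obtain ⟨ε, φ, hε, hφ⟩ := hw.exists_isUniformKL hP hKL hws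
  have hsum := hw.summable_gap hP hws hφ
  refine ⟨hsum, ⟨ε, ⊤, _, hε, hφ.const_mul (a := (P.m : ℝ) + 2) ?_, hw.tsum_gap_le hP hws hφ⟩,
    fun W η ψ hψ => hw.tsum_gap_le hP hws hψ, fun i => ?_, ?_, ?_⟩
  · have : (0 : ℝ) ≤ P.m := Nat.cast_nonneg _
    linarith
  · refine ADMMKL.Problem.tendsto_of_summable_dist hws
      ((P.A i).continuous.comp (ADMMKL.Problem.continuous_x i)) hsum fun k => ?_
    rw [dist_eq_norm]
    exact ADMMKL.Problem.norm_map_block_sub_le_gap _ _ i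
  · refine ADMMKL.Problem.tendsto_of_summable_dist hws ADMMKL.Problem.continuous_xN hsum fun k => ?_
    rw [dist_eq_norm]
    exact ADMMKL.Problem.norm_xN_sub_le_gap _ _
  · refine ADMMKL.Problem.tendsto_of_summable_dist hws ADMMKL.Problem.continuous_lam hsum fun k => ?_
    rw [dist_eq_norm]
    exact ADMMKL.Problem.norm_lam_sub_le_gap _ _
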